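/- Let $(M,g)$ be a closed (compact, without boundary) smooth Riemannian manifold of dimension $n$, let $a\neq 0$ be a real constant and let $0<T\le\infty$. Let $\varphi,\psi$ be smooth solutions on $M\times(0,T)$ of $$\frac{\partial\omega}{\partial t}=\Delta\omega+a\,\omega\ln\omega$$ with $0<\varphi<\psi$ on $M\times(0,T)$, and let $h=\varphi/\psi$. Suppose that one of the following holds: (i) $a>0$ and $\mathrm{Ric}\ge 0$; (ii) $a<0$, and there are real constants $0<c_0<1$ and $K\ge-\dfrac{\ln c_0}{1-c_0^2}-\dfrac12$ such that $c_0\psi<\varphi$ on $M\times(0,T)$ and $\mathrm{Ric}\ge -aK$ (that is, $\mathrm{Ric}(v,v)\ge -aK\,g(v,v)$ for all tangent vectors $v$). Then for all $x\in M$ and all $0<t<T$, $$\frac{\partial}{\partial t}\ln\psi-|\nabla\ln\psi|^2-a\ln\psi+\frac{an}{2(1-e^{-at})}=\Delta\ln\psi+\frac{an}{2(1-e^{-at})}\ \ge\ \frac{|\nabla h|^2}{1-h^2}.$$ -/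

import Mathlib

open scoped Manifold ContDiff

set_option maxSynthPendingDepth 3

noncomputable section

namespace RiemGeom

section VectorSpace

variable {E : Type*} [NormedAddCommGroup E] [NormedSpace ℝ E]

/-- The Koszul expression of a metric `G` in coordinates,
`(u, v, w) ↦ (∂_u G(v, w) + ∂_v G(u, w) - ∂_w G(u, v)) / 2`
(the Christoffel symbols of the first kind). -/
def christoffelLower (G : E → E →L[ℝ] E →L[ℝ] ℝ) (y : E) : E →L[ℝ] E →L[ℝ] E →L[ℝ] ℝ :=
  let D : E →L[ℝ] E →L[ℝ] E →L[ℝ] ℝ := fderiv ℝ G y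
  let D' : E →L[ℝ] E →L[ℝ] E →L[ℝ] ℝ :=
    ((ContinuousLinearMap.flipₗᵢ ℝ E E ℝ).toContinuousLinearEquiv :
      (E →L[ℝ] E →L[ℝ] ℝ) →L[ℝ] (E →L[ℝ] E →L[ℝ] ℝ)).comp D.flip
  (1 / 2 : ℝ) • (D + D.flip - D')

theorem christoffelLower_apply (G : E → E →L[ℝ] E →L[ℝ] ℝ) (y u v w : E) :
    christoffelLower G y u v w =
      (1 / 2) * (fderiv ℝ G y u v w + fderiv ℝ G y v u w - fderiv ℝ G y w u v) := by
  simp [christoffelLower]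

/-- The Christoffel symbols (of the second kind) of a metric `G` in coordinates, as a bilinear map:
`Γ(u, v)` is the vector with `G (Γ(u, v), w) = christoffelLower G y u v w` for all `w`. -/
def christoffel (G : E → E →L[ℝ] E →L[ℝ] ℝ) (y : E) : E →L[ℝ] E →L[ℝ] E :=
  (ContinuousLinearMap.compL ℝ E (E →L[ℝ] ℝ) E (G y).inverse).comp (christoffelLower G y)

theorem christoffel_apply (G : E → E →L[ℝ] E →L[ℝ] ℝ) (y u v : E) :
    christoffel G y u v = (G y).inverse (christoffelLower G y u v) := rfl

/-- The gradient of `f` with respect to a metric `G` in coordinates: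
`G (grad f, w) = ∂_w f` for all `w`. -/
def coordGradient (G : E → E →L[ℝ] E →L[ℝ] ℝ) (f : E → ℝ) (y : E) : E :=
  (G y).inverse (fderiv ℝ f y)

/-- The covariant derivative `v ↦ ∇_v X = ∂_v X + Γ(v, X)` of a vector field `X`, for the
Levi-Civita connection of a metric `G` in coordinates. -/
def covDeriv (G : E → E →L[ℝ] E →L[ℝ] ℝ) (X : E → E) (y : E) : E →L[ℝ] E :=
  fderiv ℝ X y + (christoffel G y).flip (X y)

/-- The Laplacian `div grad f = tr (v ↦ ∇_v grad f)` of a metric `G` in coordinates. -/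
def coordLaplacian (G : E → E →L[ℝ] E →L[ℝ] ℝ) (f : E → ℝ) (y : E) : ℝ :=
  LinearMap.trace ℝ E (covDeriv G (coordGradient G f) y : E →ₗ[ℝ] E)

/-- For fixed `v, w`, the endomorphism `u ↦ R(u, v) w`, where `R` is the curvature
`R(u, v) w = ∇_u ∇_v w - ∇_v ∇_u w - ∇_[u, v] w` of the Levi-Civita connection of a metric `G` in
coordinates. -/
def curvature (G : E → E →L[ℝ] E →L[ℝ] ℝ) (y v w : E) : E →L[ℝ] E :=
  ((fderiv ℝ (christoffel G) y).flip v).flip w + (christoffel G y).flip (christoffel G y v w)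
    - ((fderiv ℝ (christoffel G) y v).flip w
        + (christoffel G y v).comp ((christoffel G y).flip w))

theorem curvature_apply (G : E → E →L[ℝ] E →L[ℝ] ℝ) (y u v w : E) :
    curvature G y v w u =
      (fderiv ℝ (christoffel G) y u v w + christoffel G y u (christoffel G y v w))
      - (fderiv ℝ (christoffel G) y v u w + christoffel G y v (christoffel G y u w)) := rfl

/-- The Ricci curvature `Ric(v, w) = tr (u ↦ R(u, v) w)` of a metric `G` in coordinates. -/
def coordRicci (G : E → E →L[ℝ] E →L[ℝ] ℝ) (y v w : E) : ℝ :=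
  LinearMap.trace ℝ E (curvature G y v w : E →ₗ[ℝ] E)

end VectorSpace

section Manifold

variable {n : ℕ} {M : Type*} [TopologicalSpace M] [ChartedSpace (EuclideanSpace ℝ (Fin n)) M]
  [IsManifold (𝓡 n) ∞ M]

/-- A smooth Riemannian metric on an `n`-dimensional smooth manifold without boundary. -/
abbrev RiemannianMetric (n : ℕ) (M : Type*) [TopologicalSpace M]
    [ChartedSpace (EuclideanSpace ℝ (Fin n)) M] [IsManifold (𝓡 n) ∞ M] :=
  Bundle.ContMDiffRiemannianMetric (𝓡 n) ∞ (EuclideanSpace ℝ (Fin n))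
    (fun x : M => TangentSpace (𝓡 n) x)

/-- The expression of the metric in the preferred chart at `c`: the pullback of the metric under
the inverse of the chart. -/
def metricInChart (g : RiemannianMetric n M) (c : M) (y : EuclideanSpace ℝ (Fin n)) :
    EuclideanSpace ℝ (Fin n) →L[ℝ] EuclideanSpace ℝ (Fin n) →L[ℝ] ℝ :=
  let T : EuclideanSpace ℝ (Fin n) →L[ℝ] EuclideanSpace ℝ (Fin n) :=
    mfderiv 𝓘(ℝ, EuclideanSpace ℝ (Fin n)) (𝓡 n) (extChartAt (𝓡 n) c).symm y
  let B : EuclideanSpace ℝ (Fin n) →L[ℝ] EuclideanSpace ℝ (Fin n) →L[ℝ] ℝ :=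
    g.inner ((extChartAt (𝓡 n) c).symm y)
  B.bilinearComp T T

/-- The Riemannian gradient: `g (∇f, v) = df v` for every tangent vector `v` at `x`. -/
def gradient (g : RiemannianMetric n M) (f : M → ℝ) (x : M) : TangentSpace (𝓡 n) x :=
  (g.inner x).inverse (mfderiv (𝓡 n) 𝓘(ℝ, ℝ) f x)

/-- `|∇f|²`. -/
def gradNormSq (g : RiemannianMetric n M) (f : M → ℝ) (x : M) : ℝ :=
  g.inner x (gradient g f x) (gradient g f x)

/-- The Laplace-Beltrami operator, computed at `x` in the preferred chart at `x`. -/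
def laplacian (g : RiemannianMetric n M) (f : M → ℝ) (x : M) : ℝ :=
  coordLaplacian (metricInChart g x) (f ∘ (extChartAt (𝓡 n) x).symm) (extChartAt (𝓡 n) x x)

/-- The Ricci curvature tensor, computed at `x` in the preferred chart at `x`. -/
def ricci (g : RiemannianMetric n M) (x : M) (v w : TangentSpace (𝓡 n) x) : ℝ :=
  coordRicci (metricInChart g x) (extChartAt (𝓡 n) x x)
    (mfderiv (𝓡 n) 𝓘(ℝ, EuclideanSpace ℝ (Fin n)) (extChartAt (𝓡 n) x) x v)
    (mfderiv (𝓡 n) 𝓘(ℝ, EuclideanSpace ℝ (Fin n)) (extChartAt (𝓡 n) x) x w)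

/-- `Ric ≥ κ`, that is, `Ric(v, v) ≥ κ g(v, v)` for all tangent vectors `v`. -/
def RicciGE (g : RiemannianMetric n M) (κ : ℝ) : Prop :=
  ∀ (x : M) (v : TangentSpace (𝓡 n) x), κ * g.inner x v v ≤ ricci g x v v

/-- `u(x, t)` is a smooth solution of `∂u/∂t = Δu + a u ln u` on `M × (0, T)`. -/
structure IsSolution (g : RiemannianMetric n M) (a : ℝ) (T : EReal) (u : M → ℝ → ℝ) : Prop where
  smooth : ContMDiffOn ((𝓡 n).prod 𝓘(ℝ, ℝ)) 𝓘(ℝ, ℝ) ∞ (fun p : M × ℝ => u p.1 p.2)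
    {p : M × ℝ | 0 < p.2 ∧ (p.2 : EReal) < T}
  equation : ∀ (x : M) (t : ℝ), 0 < t → (t : EReal) < T →
    deriv (fun s => u x s) t = laplacian g (fun z => u z t) x + a * u x t * Real.log (u x t)

end Manifold

end RiemGeom

end

/-! Put f = ln ψ and θ = arcsin h. Since dh = cos θ dθ, the right-hand side |∇h|²/(1 - h²) is
exactly |∇θ|², so the claim is a lower bound for Q = Δf - |∇θ|². Both functions satisfy quasilinear
heat equations: f_t = Δf + |∇f|² + af, and θ_t = Δθ - tan θ |∇θ|² + 2⟨∇θ, ∇f⟩ + a tan θ ln sin θ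
(`deriv_quotAngle`).

At a spatial minimum of Q, Bochner's formula for f and for θ, together with dQ = 0 and ΔQ ≥ 0,
bounds Q_t - aQ below by 2|∇²f - ∇θ⊗∇θ|² + 2|∇²θ + tan θ ∇θ⊗∇θ|² + 2 Ric(∇θ, ∇θ) + 2 Ric(∇f, ∇f) -
a(1 + 2 ln h/(1 - h²))|∇θ|². If Ric ≥ κ ≥ 0 and a(1 + 2 ln h/(1 - h²)) ≤ 2κ, the last three terms
have nonnegative sum. The first square has trace Q, so Cauchy-Schwarz gives n(Q_t - aQ) ≥ 2Q²
(`evolution_inequality`). Cases (i) and (ii) are two ways to supply κ, through elementary bounds on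
ln h/(1 - h²).

Finally let τ solve τ' = 1 - aτ with τ(0) = 0. The minimum principle for τ(t - ε) Q on M × [ε, t]
gives τQ ≥ -n/2 (`expTime_mul_harnackQuantity_ge`), and ε → 0 finishes. Geometric identities are
proved in coordinates and transferred by invariance of the Laplacian under transition maps
(`laplacian_extChartAt_symm`). -/

open Filter Topology

namespace RiemGeom

/-! ### Trace inequalities for an inner product given as a bilinear form -/

section LinearAlgebra

variable {V : Type*} [AddCommGroup V] [Module ℝ V] [FiniteDimensional ℝ V]

/-- An endomorphism which is nonnegative for some inner product has nonnegative trace. -/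
theorem trace_nonneg_of_form_nonneg (B : LinearMap.BilinForm ℝ V)
    (hsymm : ∀ v w, B v w = B w v) (hpos : ∀ v, v ≠ 0 → 0 < B v v)
    (C : V →ₗ[ℝ] V) (hC : ∀ v, 0 ≤ B (C v) v) : 0 ≤ LinearMap.trace ℝ V C := by
  -- In an orthogonal basis the diagonal entries of `C` are B(C bᵢ, bᵢ)/B(bᵢ, bᵢ).
  obtain ⟨b, hb⟩ := LinearMap.BilinForm.exists_orthogonal_basis
    (B := B) ⟨fun v w => hsymm v w⟩
  have hb0 : ∀ i, 0 < B (b i) (b i) := fun i => hpos _ (b.ne_zero i)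
  have hcoord : ∀ v i, b.repr v i = B v (b i) / B (b i) (b i) := by
    intro v i
    rw [eq_div_iff (hb0 i).ne']
    conv_rhs => rw [← b.sum_repr v]
    rw [map_sum, LinearMap.sum_apply, Finset.sum_eq_single i]
    · simp
    · intro j _ hj
      have : B (b j) (b i) = 0 := hb hj
      simp [this]
    · simp
  rw [LinearMap.trace_eq_matrix_trace ℝ b, Matrix.trace]
  refine Finset.sum_nonneg fun i _ => ?_
  rw [Matrix.diag_apply, LinearMap.toMatrix_apply, hcoord]
  exact div_nonneg (hC _) (hb0 i).le

/-- Cauchy-Schwarz inequality `(tr C)² ≤ n tr C²` for a selfadjoint endomorphism `C`. -/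
theorem sq_trace_le_finrank_mul_trace_sq (B : LinearMap.BilinForm ℝ V)
    (hsymm : ∀ v w, B v w = B w v) (hpos : ∀ v, v ≠ 0 → 0 < B v v)
    (C : V →ₗ[ℝ] V) (hC : ∀ v w, B (C v) w = B v (C w)) :
    (LinearMap.trace ℝ V C) ^ 2 ≤ Module.finrank ℝ V * LinearMap.trace ℝ V (C ∘ₗ C) := by
  rcases Nat.eq_zero_or_pos (Module.finrank ℝ V) with h0 | h0
  · have : Subsingleton V := Module.finrank_zero_iff.1 h0
    have : C = 0 := by ext v; exact Subsingleton.elim _ _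
    simp [this]
  obtain ⟨n, hn⟩ : ∃ n : ℝ, n = (Module.finrank ℝ V : ℝ) := ⟨_, rfl⟩
  rw [← hn]
  have hn0 : 0 < n := by rw [hn]; exact_mod_cast h0
  set t := LinearMap.trace ℝ V C with ht
  -- This is n times the trace-free part of `C`; it is selfadjoint, so 0 ≤ tr D² = n(n tr C² - t²).
  set D : V →ₗ[ℝ] V := n • C - t • LinearMap.id with hD
  have hDs : ∀ v w, B (D v) w = B v (D w) := by
    intro v w; simp [hD, hC]
  have h := trace_nonneg_of_form_nonneg B hsymm hpos (D ∘ₗ D) (fun v => by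
    rw [LinearMap.comp_apply, hDs]
    by_cases h : D v = 0
    · simp [h]
    · exact (hpos _ h).le)
  have hDD : D ∘ₗ D = (n ^ 2) • (C ∘ₗ C) - (2 * n * t) • C + (t ^ 2) • LinearMap.id := by
    ext v; simp [hD]; module
  rw [hDD] at h
  simp only [map_add, map_sub, map_smul, smul_eq_mul, LinearMap.trace_id, ← ht, ← hn] at h
  nlinarith

end LinearAlgebra

/-! ### The Levi-Civita connection of a metric in coordinates -/

section Coordinates

variable {E : Type*} [NormedAddCommGroup E] [NormedSpace ℝ E]

/-- `G` is a smooth Riemannian metric on the open set `U`. -/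
structure IsMetricOn (G : E → E →L[ℝ] E →L[ℝ] ℝ) (U : Set E) : Prop where
  isOpen : IsOpen U
  smooth : ContDiffOn ℝ ∞ G U
  symm : ∀ y ∈ U, ∀ v w, G y v w = G y w v
  pos : ∀ y ∈ U, ∀ v, v ≠ 0 → 0 < G y v v

variable {G : E → E →L[ℝ] E →L[ℝ] ℝ} {U : Set E} {y : E}

namespace IsMetricOn

theorem mem_nhds (hG : IsMetricOn G U) (hy : y ∈ U) : U ∈ 𝓝 y := hG.isOpen.mem_nhds hy

theorem contDiffAt (hG : IsMetricOn G U) (hy : y ∈ U) : ContDiffAt ℝ ∞ G y :=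
  hG.smooth.contDiffAt (hG.mem_nhds hy)

theorem differentiableAt (hG : IsMetricOn G U) (hy : y ∈ U) : DifferentiableAt ℝ G y :=
  (hG.contDiffAt hy).differentiableAt (by simp)

theorem nonneg (hG : IsMetricOn G U) (hy : y ∈ U) (v : E) : 0 ≤ G y v v := by
  by_cases h : v = 0
  · simp [h]
  · exact (hG.pos y hy v h).le

theorem ext (hG : IsMetricOn G U) (hy : y ∈ U) {v w : E} (h : ∀ z, G y v z = G y w z) :
    v = w := by
  by_contra hne
  have := hG.pos y hy (v - w) (sub_ne_zero.2 hne)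
  simp [h] at this

theorem fderiv_symm (hG : IsMetricOn G U) (hy : y ∈ U) (u v w : E) :
    fderiv ℝ G y u v w = fderiv ℝ G y u w v := by
  have h : ∀ v w : E, fderiv ℝ (fun z => G z v w) y u = fderiv ℝ G y u v w := by
    intro v w
    have h1 := ((hG.differentiableAt hy).hasFDerivAt.clm_apply
      (hasFDerivAt_const v y)).clm_apply (hasFDerivAt_const w y)
    rw [h1.fderiv]; simp
  rw [← h, ← h]
  congr 1
  apply Filter.EventuallyEq.fderiv_eq
  filter_upwards [hG.mem_nhds hy] with z hz using hG.symm z hz v w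

theorem contDiffOn_fderiv (hG : IsMetricOn G U) : ContDiffOn ℝ ∞ (fderiv ℝ G) U :=
  hG.smooth.fderiv_of_isOpen hG.isOpen (by simp)

/-- The bilinear form of the metric at a point. -/
def form (G : E → E →L[ℝ] E →L[ℝ] ℝ) (y : E) : LinearMap.BilinForm ℝ E :=
  (ContinuousLinearMap.coeLM ℝ).comp (G y : E →ₗ[ℝ] (E →L[ℝ] ℝ))

@[simp]
theorem form_apply (G : E → E →L[ℝ] E →L[ℝ] ℝ) (y v w : E) : form G y v w = G y v w := rfl

theorem contDiffOn_christoffelLower (hG : IsMetricOn G U) :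
    ContDiffOn ℝ ∞ (christoffelLower G) U := by
  have hD := hG.contDiffOn_fderiv
  have hflip : ContDiffOn ℝ ∞ (fun y => (fderiv ℝ G y).flip) U :=
    (ContinuousLinearMap.flipₗᵢ ℝ E E (E →L[ℝ] ℝ)).contDiff.comp_contDiffOn hD
  unfold christoffelLower
  exact ContDiffOn.const_smul (1 / 2 : ℝ) ((hD.add hflip).sub (contDiffOn_const.clm_comp hflip))

variable [FiniteDimensional ℝ E]

/-- Guarantees that `(G y).inverse`, on which the gradient and the Christoffel symbols are built, is
a true inverse and not the default value 0. -/
theorem isInvertible (hG : IsMetricOn G U) (hy : y ∈ U) : (G y).IsInvertible := by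
  have hinj : Function.Injective (G y) := fun v w h => hG.ext hy (fun z => by rw [h])
  have hd : Module.finrank ℝ E = Module.finrank ℝ (E →L[ℝ] ℝ) := by
    rw [← LinearEquiv.finrank_eq (LinearMap.toContinuousLinearMap (𝕜 := ℝ) (E := E) (F' := ℝ))]
    exact (Subspace.dual_finrank_eq).symm
  let e := (LinearEquiv.ofInjectiveOfFinrankEq (G y : E →ₗ[ℝ] (E →L[ℝ] ℝ)) hinj hd)
  exact ⟨e.toContinuousLinearEquiv, by ext; rfl⟩

theorem apply_inverse (hG : IsMetricOn G U) (hy : y ∈ U) (l : E →L[ℝ] ℝ) :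
    G y ((G y).inverse l) = l :=
  (((hG.isInvertible hy).inverse_apply_eq).1 rfl).symm

theorem apply_gradient (hG : IsMetricOn G U) (hy : y ∈ U) (f : E → ℝ) (w : E) :
    G y (coordGradient G f y) w = fderiv ℝ f y w := by
  rw [coordGradient, hG.apply_inverse hy]

theorem apply_christoffel (hG : IsMetricOn G U) (hy : y ∈ U) (u v w : E) :
    G y (christoffel G y u v) w =
      (1 / 2) * (fderiv ℝ G y u v w + fderiv ℝ G y v u w - fderiv ℝ G y w u v) := by
  rw [christoffel_apply, hG.apply_inverse hy, christoffelLower_apply]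

theorem christoffel_symm (hG : IsMetricOn G U) (hy : y ∈ U) (u v : E) :
    christoffel G y u v = christoffel G y v u := by
  refine hG.ext hy fun w => ?_
  rw [hG.apply_christoffel hy, hG.apply_christoffel hy, hG.fderiv_symm hy w u v]; ring

/-- Compatibility of the Levi-Civita connection with the metric. -/
theorem fderiv_apply_eq (hG : IsMetricOn G U) (hy : y ∈ U) (u v w : E) :
    fderiv ℝ G y u v w = G y (christoffel G y u v) w + G y v (christoffel G y u w) := by
  rw [hG.symm y hy v, hG.apply_christoffel hy, hG.apply_christoffel hy,
    hG.fderiv_symm hy u w v]; ring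

theorem contDiffOn_inverse (hG : IsMetricOn G U) :
    ContDiffOn ℝ ∞ (fun y => (G y).inverse) U := fun _ hy =>
  (((hG.isInvertible hy).contDiffAt_map_inverse).comp _ (hG.contDiffAt hy)).contDiffWithinAt

theorem contDiffOn_christoffel (hG : IsMetricOn G U) :
    ContDiffOn ℝ ∞ (christoffel G) U := by
  unfold christoffel
  exact ((ContinuousLinearMap.compL ℝ E (E →L[ℝ] ℝ) E).contDiff.comp_contDiffOn
    hG.contDiffOn_inverse).clm_comp hG.contDiffOn_christoffelLower

end IsMetricOn

end Coordinates

/-! ### Gradient, Hessian and Bochner's formula in coordinates -/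

section Coordinates

variable {E : Type*} [NormedAddCommGroup E] [NormedSpace ℝ E]
  {G : E → E →L[ℝ] E →L[ℝ] ℝ} {U : Set E} {y : E} {f h : E → ℝ} {X Y : E → E}

/-- `⟨∇f, ∇h⟩` for a metric `G` in coordinates. -/
noncomputable def coordGradInner (G : E → E →L[ℝ] E →L[ℝ] ℝ) (f h : E → ℝ) (y : E) : ℝ :=
  G y (coordGradient G f y) (coordGradient G h y)

/-- The Hessian of `f` as an endomorphism, `v ↦ ∇_v ∇f`. -/
noncomputable def coordHessian (G : E → E →L[ℝ] E →L[ℝ] ℝ) (f : E → ℝ) (y : E) : E →L[ℝ] E :=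
  covDeriv G (coordGradient G f) y

theorem covDeriv_apply (G : E → E →L[ℝ] E →L[ℝ] ℝ) (X : E → E) (y v : E) :
    covDeriv G X y v = fderiv ℝ X y v + christoffel G y v (X y) := rfl

/-- The trace as a continuous linear map. -/
noncomputable def traceCLM (E : Type*) [NormedAddCommGroup E] [NormedSpace ℝ E]
    [FiniteDimensional ℝ E] : (E →L[ℝ] E) →L[ℝ] ℝ :=
  LinearMap.toContinuousLinearMap
    ((LinearMap.trace ℝ E).comp (ContinuousLinearMap.coeLM ℝ : (E →L[ℝ] E) →ₗ[ℝ] (E →ₗ[ℝ] E)))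

theorem traceCLM_apply [FiniteDimensional ℝ E] (C : E →L[ℝ] E) :
    traceCLM E C = LinearMap.trace ℝ E (C : E →ₗ[ℝ] E) := rfl

theorem coordLaplacian_eq [FiniteDimensional ℝ E] (G : E → E →L[ℝ] E →L[ℝ] ℝ) (f : E → ℝ)
    (y : E) : coordLaplacian G f y = traceCLM E (coordHessian G f y) := rfl

theorem traceCLM_comp_comm [FiniteDimensional ℝ E] (C D : E →L[ℝ] E) :
    traceCLM E (C.comp D) = traceCLM E (D.comp C) := by
  rw [traceCLM_apply, traceCLM_apply]
  exact LinearMap.trace_comp_comm' _ _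

theorem traceCLM_smulRight [FiniteDimensional ℝ E] (l : E →L[ℝ] ℝ) (x : E) :
    traceCLM E (l.smulRight x) = l x := by
  rw [traceCLM_apply]
  exact LinearMap.trace_smulRight (l : E →ₗ[ℝ] ℝ) x

theorem coordGradient_congr (hfh : f =ᶠ[𝓝 y] h) : coordGradient G f y = coordGradient G h y := by
  rw [coordGradient, hfh.fderiv_eq, coordGradient]

theorem coordGradInner_congr {f' h' : E → ℝ} (hf : f =ᶠ[𝓝 y] f') (hh : h =ᶠ[𝓝 y] h') :
    coordGradInner G f h y = coordGradInner G f' h' y := by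
  rw [coordGradInner, coordGradient_congr hf, coordGradient_congr hh, coordGradInner]

theorem coordHessian_congr (hfh : f =ᶠ[𝓝 y] h) : coordHessian G f y = coordHessian G h y := by
  have h1 : coordGradient G f =ᶠ[𝓝 y] coordGradient G h :=
    hfh.eventuallyEq_nhds.mono fun z hz => coordGradient_congr hz
  rw [coordHessian, coordHessian, covDeriv, covDeriv, h1.fderiv_eq, h1.eq_of_nhds]

theorem coordLaplacian_congr (hfh : f =ᶠ[𝓝 y] h) : coordLaplacian G f y = coordLaplacian G h y := by
  have := coordHessian_congr (G := G) hfh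
  unfold coordHessian at this
  rw [coordLaplacian, this, coordLaplacian]

theorem two_le_infty : (2 : WithTop ℕ∞) ≤ ∞ :=
  ENat.LEInfty.out

namespace IsMetricOn

theorem gradInner_comm (hG : IsMetricOn G U) (hy : y ∈ U) (f h : E → ℝ) :
    coordGradInner G f h y = coordGradInner G h f y := hG.symm y hy _ _

theorem differentiableAt_of_contDiffOn (hG : IsMetricOn G U) (hy : y ∈ U)
    {F : Type*} [NormedAddCommGroup F] [NormedSpace ℝ F] {k : E → F}
    (hk : ContDiffOn ℝ ∞ k U) : DifferentiableAt ℝ k y :=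
  (hk.contDiffAt (hG.mem_nhds hy)).differentiableAt (by simp)

theorem hasFDerivAt_of_contDiffOn (hG : IsMetricOn G U) (hy : y ∈ U)
    {F : Type*} [NormedAddCommGroup F] [NormedSpace ℝ F] {k : E → F}
    (hk : ContDiffOn ℝ ∞ k U) : HasFDerivAt k (fderiv ℝ k y) y :=
  (hG.differentiableAt_of_contDiffOn hy hk).hasFDerivAt

variable [FiniteDimensional ℝ E]

theorem contDiffOn_gradient (hG : IsMetricOn G U) (hf : ContDiffOn ℝ ∞ f U) :
    ContDiffOn ℝ ∞ (coordGradient G f) U :=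
  hG.contDiffOn_inverse.clm_apply (hf.fderiv_of_isOpen hG.isOpen (by simp))

theorem contDiffOn_covDeriv (hG : IsMetricOn G U) (hX : ContDiffOn ℝ ∞ X U) :
    ContDiffOn ℝ ∞ (covDeriv G X) U := by
  have hflip : ContDiffOn ℝ ∞ (fun y => (christoffel G y).flip) U :=
    (ContinuousLinearMap.flipₗᵢ ℝ E E E).contDiff.comp_contDiffOn hG.contDiffOn_christoffel
  exact (hX.fderiv_of_isOpen hG.isOpen (by simp)).add (hflip.clm_apply hX)

theorem contDiffOn_hessian (hG : IsMetricOn G U) (hf : ContDiffOn ℝ ∞ f U) :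
    ContDiffOn ℝ ∞ (coordHessian G f) U :=
  hG.contDiffOn_covDeriv (hG.contDiffOn_gradient hf)

theorem contDiffOn_laplacian (hG : IsMetricOn G U) (hf : ContDiffOn ℝ ∞ f U) :
    ContDiffOn ℝ ∞ (coordLaplacian G f) U :=
  (traceCLM E).contDiff.comp_contDiffOn (hG.contDiffOn_hessian hf)

theorem contDiffOn_gradInner (hG : IsMetricOn G U) (hf : ContDiffOn ℝ ∞ f U)
    (hh : ContDiffOn ℝ ∞ h U) : ContDiffOn ℝ ∞ (coordGradInner G f h) U :=
  (hG.smooth.clm_apply (hG.contDiffOn_gradient hf)).clm_apply (hG.contDiffOn_gradient hh)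

theorem gradInner_eq (hG : IsMetricOn G U) (hy : y ∈ U) (f h : E → ℝ) :
    coordGradInner G f h y = fderiv ℝ f y (coordGradient G h y) := by
  rw [coordGradInner, hG.apply_gradient hy]

theorem hasFDerivAt_apply (hG : IsMetricOn G U) (hy : y ∈ U)
    (hX : DifferentiableAt ℝ X y) (hY : DifferentiableAt ℝ Y y) :
    HasFDerivAt (fun z => G z (X z) (Y z))
      ((G y (X y)).comp (covDeriv G Y y) + (G y (Y y)).comp (covDeriv G X y)) y := by
  have h1 := ((hG.differentiableAt hy).hasFDerivAt.clm_apply hX.hasFDerivAt).clm_apply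
    hY.hasFDerivAt
  refine h1.congr_fderiv ?_
  ext v
  simp only [add_apply, ContinuousLinearMap.comp_apply, covDeriv_apply,
    ContinuousLinearMap.flip_apply, map_add, hG.fderiv_apply_eq hy]
  rw [hG.symm y hy (Y y), hG.symm y hy (Y y)]
  ring

/-- The Hessian in terms of the second derivative. -/
theorem apply_hessian (hG : IsMetricOn G U) (hf : ContDiffOn ℝ ∞ f U) (hy : y ∈ U) (v w : E) :
    G y (coordHessian G f y v) w
      = fderiv ℝ (fderiv ℝ f) y v w - fderiv ℝ f y (christoffel G y v w) := by
  have hX := hG.hasFDerivAt_of_contDiffOn hy (hG.contDiffOn_gradient hf)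
  have h1 := (hG.differentiableAt hy).hasFDerivAt.clm_apply hX
  -- Differentiate G(∇f, ·) = df; metric compatibility turns the derivative of `G` into Christoffel
  -- terms.
  have h2 : (fun z => G z (coordGradient G f z)) =ᶠ[𝓝 y] fderiv ℝ f := by
    filter_upwards [hG.mem_nhds hy] with z hz
    ext w; exact hG.apply_gradient hz f w
  have h3 := congrArg (fun L => L v w) (h1.congr_of_eventuallyEq h2.symm).fderiv
  simp only [add_apply, ContinuousLinearMap.comp_apply,
    ContinuousLinearMap.flip_apply, hG.fderiv_apply_eq hy] at h3
  rw [h3, ← hG.apply_gradient hy, coordHessian, covDeriv_apply, map_add,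
    add_apply]
  ring

/-- Symmetry of second derivatives combined with vanishing torsion. -/
theorem hessian_symm (hG : IsMetricOn G U) (hf : ContDiffOn ℝ ∞ f U) (hy : y ∈ U) (v w : E) :
    G y (coordHessian G f y v) w = G y v (coordHessian G f y w) := by
  have hs : IsSymmSndFDerivAt ℝ f y :=
    (hf.contDiffAt (hG.mem_nhds hy)).isSymmSndFDerivAt (by simpa using two_le_infty)
  rw [hG.symm y hy v, hG.apply_hessian hf hy, hG.apply_hessian hf hy, hs.eq,
    hG.christoffel_symm hy]

theorem fderiv_gradInner (hG : IsMetricOn G U) (hf : ContDiffOn ℝ ∞ f U)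
    (hh : ContDiffOn ℝ ∞ h U) (hy : y ∈ U) (v : E) :
    fderiv ℝ (coordGradInner G f h) y v
      = G y (coordHessian G f y (coordGradient G h y)) v
        + G y (coordHessian G h y (coordGradient G f y)) v := by
  have h1 := hG.hasFDerivAt_apply hy
    (hG.differentiableAt_of_contDiffOn hy (hG.contDiffOn_gradient hf))
    (hG.differentiableAt_of_contDiffOn hy (hG.contDiffOn_gradient hh))
  have h2 : fderiv ℝ (coordGradInner G f h) y = _ := h1.fderiv
  rw [h2, hG.hessian_symm hf hy, hG.hessian_symm hh hy]
  simp only [add_apply, ContinuousLinearMap.comp_apply]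
  unfold coordHessian
  ring

theorem gradient_gradInner_self (hG : IsMetricOn G U) (hf : ContDiffOn ℝ ∞ f U) (hy : y ∈ U) :
    coordGradient G (coordGradInner G f f) y
      = (2 : ℝ) • coordHessian G f y (coordGradient G f y) := by
  refine hG.ext hy fun v => ?_
  rw [hG.apply_gradient hy, hG.fderiv_gradInner hf hf hy, map_smul,
    smul_apply, smul_eq_mul]
  ring

/-- Bochner's formula. -/
theorem laplacian_gradInner_self (hG : IsMetricOn G U) (hf : ContDiffOn ℝ ∞ f U) (hy : y ∈ U) :
    coordLaplacian G (coordGradInner G f f) y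
      = 2 * traceCLM E ((coordHessian G f y).comp (coordHessian G f y))
        + 2 * fderiv ℝ (coordLaplacian G f) y (coordGradient G f y)
        + 2 * coordRicci G y (coordGradient G f y) (coordGradient G f y) := by
  have hXs := hG.contDiffOn_gradient hf
  have hAs := hG.contDiffOn_hessian hf
  have hX := hG.hasFDerivAt_of_contDiffOn hy hXs
  have hA := hG.hasFDerivAt_of_contDiffOn hy hAs
  have hΓ := hG.hasFDerivAt_of_contDiffOn hy hG.contDiffOn_christoffel
  have hDX := hG.hasFDerivAt_of_contDiffOn hy (hXs.fderiv_of_isOpen hG.isOpen (by simp))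
  have hs : IsSymmSndFDerivAt ℝ (coordGradient G f) y :=
    (hXs.contDiffAt (hG.mem_nhds hy)).isSymmSndFDerivAt (by simpa using two_le_infty)
  obtain ⟨X, hXdef⟩ : ∃ X, X = coordGradient G f y := ⟨_, rfl⟩
  obtain ⟨A, hAdef⟩ : ∃ A, A = coordHessian G f y := ⟨_, rfl⟩
  obtain ⟨DA, hDAdef⟩ : ∃ DA, DA = fderiv ℝ (coordHessian G f) y := ⟨_, rfl⟩
  obtain ⟨Γ, hΓdef⟩ : ∃ Γ, Γ = christoffel G y := ⟨_, rfl⟩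
  have hAv : ∀ v, A v = fderiv ℝ (coordGradient G f) y v + Γ v X := by
    intro v; rw [hAdef, hXdef, hΓdef]; rfl
  have hDA : ∀ v w, DA v w = fderiv ℝ (fderiv ℝ (coordGradient G f)) y v w
      + fderiv ℝ (christoffel G) y v w X + Γ w (fderiv ℝ (coordGradient G f) y v) := by
    intro v w
    have h1 := (hDX.clm_apply (hasFDerivAt_const w y)).add
      ((hΓ.clm_apply (hasFDerivAt_const w y)).clm_apply hX)
    have h2 : (fun z => coordHessian G f z w) = (fun z =>
      fderiv ℝ (coordGradient G f) z w + christoffel G z w (coordGradient G f z)) := rfl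
    have h3 := hA.clm_apply (hasFDerivAt_const w y)
    have h4 := congrArg (fun L => L v) (h3.unique (by rw [h2]; exact h1))
    simp only [add_apply, ContinuousLinearMap.comp_apply,
      ContinuousLinearMap.flip_apply, zero_apply, map_zero, zero_add] at h4
    rw [hDAdef, hXdef, hΓdef, h4]
    abel
  have hgrad : coordGradient G (coordGradInner G f f) =ᶠ[𝓝 y]
      fun z => (2 : ℝ) • coordHessian G f z (coordGradient G f z) := by
    filter_upwards [hG.mem_nhds hy] with z hz using hG.gradient_gradInner_self hf hz
  -- The left side is 2∇(A X). Exchanging ∇_v and ∇_X in ∇∇X produces the curvature. The middle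
  -- bracket is ∇_X A; its commutator part [Γ X, A] has trace zero, so its trace is the derivative
  -- of Δf along X.
  have hH : coordHessian G (coordGradInner G f f) y
      = (2 : ℝ) • (A.comp A + (DA X + (Γ X).comp A - A.comp (Γ X)) + curvature G y X X) := by
    have h1 : HasFDerivAt (fun z => (2 : ℝ) • coordHessian G f z (coordGradient G f z)) _ y :=
      (hA.clm_apply hX).const_smul (2 : ℝ)
    ext v
    rw [coordHessian, covDeriv_apply, hgrad.fderiv_eq, hgrad.eq_of_nhds, h1.fderiv]
    simp only [add_apply, ContinuousLinearMap.comp_apply,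
      ContinuousLinearMap.flip_apply, smul_apply,
      sub_apply, curvature_apply, map_smul, ← hXdef, ← hAdef, ← hDAdef,
      ← hΓdef]
    rw [← smul_add]
    congr 1
    rw [hDA v X, hDA X v, hs.eq v X]
    have hsy : ∀ u w, Γ u w = Γ w u := by rw [hΓdef]; exact hG.christoffel_symm hy
    rw [hAv X, hAv (A v), hAv v, map_add, map_add, map_add, hAv, hAv]
    simp only [map_add, add_apply]
    rw [hsy X v]
    abel
  have htr : fderiv ℝ (coordLaplacian G f) y X = traceCLM E (DA X) := by
    have h1 := (traceCLM E).hasFDerivAt.comp y hA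
    have h2 : fderiv ℝ (coordLaplacian G f) y = _ := h1.fderiv
    rw [h2, hDAdef]; rfl
  rw [coordLaplacian_eq, hH, ← hXdef, ← hAdef, htr, map_smul, map_add, map_add, map_sub, map_add,
    traceCLM_comp_comm (Γ X) A, coordRicci, ← traceCLM_apply, smul_eq_mul]
  ring

end IsMetricOn

end Coordinates

/-! ### Minima, chain rules and isometry invariance of the Laplacian -/

/-- The second derivative of a function of one variable is nonnegative at a local minimum. -/
theorem second_deriv_nonneg_of_isLocalMin {u u' : ℝ → ℝ} {c t : ℝ}
    (hu : ∀ᶠ s in 𝓝 t, HasDerivAt u (u' s) s) (hu' : HasDerivAt u' c t)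
    (hmin : IsLocalMin u t) : 0 ≤ c := by
  by_contra! hc
  have hd : deriv u =ᶠ[𝓝 t] u' := hu.mono fun s hs => hs.deriv
  have hdd : deriv (deriv u) t = c := by rw [hd.deriv_eq, hu'.deriv]
  -- A negative second derivative would make the point a local maximum too, hence the function
  -- locally constant, forcing `c = 0`.
  have hmax := isLocalMax_of_deriv_deriv_neg (by rwa [hdd]) hmin.deriv_eq_zero
    hu.self_of_nhds.continuousAt
  have hconst : u =ᶠ[𝓝 t] fun _ => u t := by
    filter_upwards [hmin, hmax] with s h1 h2 using le_antisymm h2 h1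
  have h0 : deriv u =ᶠ[𝓝 t] fun _ => 0 := by
    filter_upwards [hconst.eventuallyEq_nhds] with s hs
    rw [hs.deriv_eq]; simp
  rw [h0.deriv_eq] at hdd
  simp at hdd
  exact hc.ne hdd.symm

section Coordinates

variable {E : Type*} [NormedAddCommGroup E] [NormedSpace ℝ E]

theorem snd_fderiv_nonneg_of_isLocalMin {u : E → ℝ} {y : E}
    (hu : ContDiffAt ℝ 2 u y) (hmin : IsLocalMin u y) (v : E) :
    0 ≤ fderiv ℝ (fderiv ℝ u) y v v := by
  have hline : ∀ s : ℝ, HasDerivAt (fun s : ℝ => y + s • v) v s := fun s => by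
    simpa using ((hasDerivAt_id s).smul_const v).const_add y
  have hcont : Tendsto (fun s : ℝ => y + s • v) (𝓝 0) (𝓝 y) := by
    have := (hline 0).continuousAt.tendsto
    simpa using this
  have h1 : ∀ᶠ z in 𝓝 y, DifferentiableAt ℝ u z :=
    (hu.eventually (by simp)).mono fun z hz => hz.differentiableAt (by simp)
  have h2 : DifferentiableAt ℝ (fderiv ℝ u) y :=
    (hu.fderiv_right (m := 1) (by norm_num [one_add_one_eq_two])).differentiableAt (by simp)
  refine second_deriv_nonneg_of_isLocalMin (u := fun s : ℝ => u (y + s • v))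
    (u' := fun s => fderiv ℝ u (y + s • v) v) (t := 0) ?_ ?_ ?_
  · filter_upwards [hcont.eventually h1] with s hs
    exact hs.hasFDerivAt.comp_hasDerivAt s (hline s)
  · have h3 : HasDerivAt (fun s : ℝ => fderiv ℝ u (y + s • v)) (fderiv ℝ (fderiv ℝ u) y v) 0 :=
      h2.hasFDerivAt.comp_hasDerivAt_of_eq 0 (hline 0) (by simp)
    exact (ContinuousLinearMap.apply ℝ ℝ v).hasFDerivAt.comp_hasDerivAt 0 h3
  · have := hcont.eventually hmin
    simpa [IsLocalMin, IsMinFilter] using this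

variable {G : E → E →L[ℝ] E →L[ℝ] ℝ} {U : Set E} {y : E} {f h : E → ℝ} {X Y : E → E}

theorem coordGradient_add (hf : DifferentiableAt ℝ f y) (hh : DifferentiableAt ℝ h y) :
    coordGradient G (fun z => f z + h z) y = coordGradient G f y + coordGradient G h y := by
  rw [coordGradient, fderiv_fun_add hf hh, map_add, coordGradient, coordGradient]

theorem coordGradient_comp {k : ℝ → ℝ} {c : ℝ} (hf : DifferentiableAt ℝ f y)
    (hk : HasDerivAt k c (f y)) :
    coordGradient G (fun z => k (f z)) y = c • coordGradient G f y := by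
  have : HasFDerivAt (fun z => k (f z)) (c • fderiv ℝ f y) y :=
    hk.comp_hasFDerivAt y hf.hasFDerivAt
  rw [coordGradient, this.fderiv, map_smul, coordGradient]

theorem coordGradInner_add_left {e : E → ℝ} (he : DifferentiableAt ℝ e y)
    (hf : DifferentiableAt ℝ f y) :
    coordGradInner G (fun z => e z + f z) h y
      = coordGradInner G e h y + coordGradInner G f h y := by
  rw [coordGradInner, coordGradient_add he hf, map_add, add_apply, coordGradInner, coordGradInner]

theorem coordGradInner_add_right {e : E → ℝ} (he : DifferentiableAt ℝ e y)
    (hf : DifferentiableAt ℝ f y) :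
    coordGradInner G h (fun z => e z + f z) y
      = coordGradInner G h e y + coordGradInner G h f y := by
  rw [coordGradInner, coordGradient_add he hf, map_add, coordGradInner, coordGradInner]

theorem coordGradInner_comp_left {k : ℝ → ℝ} {c : ℝ} (hf : DifferentiableAt ℝ f y)
    (hk : HasDerivAt k c (f y)) :
    coordGradInner G (fun z => k (f z)) h y = c * coordGradInner G f h y := by
  rw [coordGradInner, coordGradient_comp hf hk, map_smul, smul_apply, smul_eq_mul, coordGradInner]

theorem coordGradInner_comp_right {k : ℝ → ℝ} {c : ℝ} (hf : DifferentiableAt ℝ f y)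
    (hk : HasDerivAt k c (f y)) :
    coordGradInner G h (fun z => k (f z)) y = c * coordGradInner G h f y := by
  rw [coordGradInner, coordGradient_comp hf hk, map_smul, smul_eq_mul, coordGradInner]

namespace IsMetricOn

variable [FiniteDimensional ℝ E]

theorem laplacian_add (hG : IsMetricOn G U) (hf : ContDiffOn ℝ ∞ f U) (hh : ContDiffOn ℝ ∞ h U)
    (hy : y ∈ U) :
    coordLaplacian G (fun z => f z + h z) y = coordLaplacian G f y + coordLaplacian G h y := by
  have h1 : coordGradient G (fun z => f z + h z) =ᶠ[𝓝 y]
      fun z => coordGradient G f z + coordGradient G h z := by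
    filter_upwards [hG.mem_nhds hy] with z hz
    exact coordGradient_add (hG.differentiableAt_of_contDiffOn hz hf)
      (hG.differentiableAt_of_contDiffOn hz hh)
  rw [coordLaplacian_eq, coordLaplacian_eq, coordLaplacian_eq, ← map_add]
  congr 1
  ext v
  simp only [coordHessian, covDeriv_apply, add_apply]
  rw [h1.fderiv_eq, h1.eq_of_nhds, fderiv_fun_add
    (hG.differentiableAt_of_contDiffOn hy (hG.contDiffOn_gradient hf))
    (hG.differentiableAt_of_contDiffOn hy (hG.contDiffOn_gradient hh)), map_add, add_apply]
  abel

/-- The chain rule for the Laplacian. -/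
theorem laplacian_comp (hG : IsMetricOn G U) (hf : ContDiffOn ℝ ∞ f U) (hy : y ∈ U)
    {k k' : ℝ → ℝ} {c : ℝ} (hk : ∀ᶠ s in 𝓝 (f y), HasDerivAt k (k' s) s)
    (hk' : HasDerivAt k' c (f y)) :
    coordLaplacian G (fun z => k (f z)) y
      = k' (f y) * coordLaplacian G f y + c * coordGradInner G f f y := by
  have hfd := hG.differentiableAt_of_contDiffOn hy hf
  have h1 : coordGradient G (fun z => k (f z)) =ᶠ[𝓝 y]
      fun z => k' (f z) • coordGradient G f z := by
    filter_upwards [hG.mem_nhds hy, hfd.continuousAt.eventually hk] with z hz hkz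
    exact coordGradient_comp (hG.differentiableAt_of_contDiffOn hz hf) hkz
  have h2 : HasFDerivAt (fun z => k' (f z)) (c • fderiv ℝ f y) y :=
    hk'.comp_hasFDerivAt y hfd.hasFDerivAt
  have h3 := h2.smul (hG.hasFDerivAt_of_contDiffOn hy (hG.contDiffOn_gradient hf))
  have h4 : coordHessian G (fun z => k (f z)) y = k' (f y) • coordHessian G f y
      + c • (fderiv ℝ f y).smulRight (coordGradient G f y) := by
    ext v
    simp only [coordHessian, covDeriv_apply, add_apply, smul_apply]
    rw [h1.fderiv_eq, h1.eq_of_nhds]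
    have h5 : fderiv ℝ (fun z => k' (f z) • coordGradient G f z) y = _ := h3.fderiv
    rw [h5]
    simp only [add_apply, smul_apply, map_smul, ContinuousLinearMap.smulRight_apply, smul_add,
      smul_smul, smul_eq_mul]
    abel
  rw [coordLaplacian_eq, h4, map_add, map_smul, map_smul, traceCLM_smulRight,
    ← hG.gradInner_eq hy, smul_eq_mul, smul_eq_mul, ← coordLaplacian_eq]

theorem laplacian_const_mul (hG : IsMetricOn G U) (hf : ContDiffOn ℝ ∞ f U) (hy : y ∈ U) (c : ℝ) :
    coordLaplacian G (fun z => c * f z) y = c * coordLaplacian G f y := by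
  have h := hG.laplacian_comp hf hy (k := fun s => c * s) (k' := fun _ => c) (c := 0)
    (Eventually.of_forall fun s => by simpa using (hasDerivAt_id s).const_mul c)
    (hasDerivAt_const _ _)
  simpa using h

/-- At a critical point the Christoffel term of the Hessian vanishes, leaving the ordinary second
derivative, which is nonnegative on every line. -/
theorem laplacian_nonneg_of_isLocalMin (hG : IsMetricOn G U) (hf : ContDiffOn ℝ ∞ f U)
    (hy : y ∈ U) (hmin : IsLocalMin f y) : 0 ≤ coordLaplacian G f y := by
  refine trace_nonneg_of_form_nonneg (form G y) (hG.symm y hy) (hG.pos y hy) _ fun v => ?_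
  have h1 : G y (coordHessian G f y v) v = fderiv ℝ (fderiv ℝ f) y v v := by
    rw [hG.apply_hessian hf hy, hmin.fderiv_eq_zero]; simp
  have h2 := snd_fderiv_nonneg_of_isLocalMin
    ((hf.contDiffAt (hG.mem_nhds hy)).of_le two_le_infty) hmin v
  rw [← h1] at h2
  exact h2

/-- The Laplacian is invariant under isometries. -/
theorem laplacian_comp_isometry {G' : E → E →L[ℝ] E →L[ℝ] ℝ} {U' : Set E} {Φ : E → E}
    (hG : IsMetricOn G U) (hG' : IsMetricOn G' U') (hΦ : ContDiffOn ℝ ∞ Φ U')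
    (hmaps : Set.MapsTo Φ U' U)
    (hiso : ∀ z ∈ U', ∀ v w, G' z v w = G (Φ z) (fderiv ℝ Φ z v) (fderiv ℝ Φ z w))
    (hf : ContDiffOn ℝ ∞ f U) (hy : y ∈ U') :
    coordLaplacian G' (f ∘ Φ) y = coordLaplacian G f (Φ y) := by
  have hΦd := hG'.hasFDerivAt_of_contDiffOn hy hΦ
  have hΦ'd := hG'.hasFDerivAt_of_contDiffOn hy (hΦ.fderiv_of_isOpen hG'.isOpen (m := ∞) (by simp))
  have hs : IsSymmSndFDerivAt ℝ Φ y :=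
    (hΦ.contDiffAt (hG'.mem_nhds hy)).isSymmSndFDerivAt (by simpa using two_le_infty)
  have hbij : ∀ z ∈ U', Function.Bijective (fderiv ℝ Φ z) := by
    intro z hz
    have hinj : Function.Injective (fderiv ℝ Φ z : E →ₗ[ℝ] E) := by
      rw [← LinearMap.ker_eq_bot, LinearMap.ker_eq_bot']
      intro v hv
      by_contra hne
      have := hG'.pos z hz v hne
      rw [hiso z hz] at this
      have hv' : fderiv ℝ Φ z v = 0 := hv
      simp [hv'] at this
    exact ⟨hinj, LinearMap.injective_iff_surjective.1 hinj⟩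
  have hfΦ : ContDiffOn ℝ ∞ (f ∘ Φ) U' := hf.comp hΦ hmaps
  have hgrad : (fun z => fderiv ℝ Φ z (coordGradient G' (f ∘ Φ) z)) =ᶠ[𝓝 y]
      fun z => coordGradient G f (Φ z) := by
    filter_upwards [hG'.mem_nhds hy] with z hz
    refine hG.ext (hmaps hz) fun w => ?_
    obtain ⟨w, rfl⟩ := (hbij z hz).2 w
    rw [← hiso z hz, hG'.apply_gradient hz, hG.apply_gradient (hmaps hz),
      fderiv_comp z (hG.differentiableAt_of_contDiffOn (hmaps hz) hf)
        (hG'.differentiableAt_of_contDiffOn hz hΦ)]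
    rfl
  -- The transformation law of the Christoffel symbols
  have hΓ : ∀ u v, fderiv ℝ Φ y (christoffel G' y u v)
      = fderiv ℝ (fderiv ℝ Φ) y u v + christoffel G (Φ y) (fderiv ℝ Φ y u) (fderiv ℝ Φ y v) := by
    have hDG : ∀ u v w, fderiv ℝ G' y u v w
        = fderiv ℝ G (Φ y) (fderiv ℝ Φ y u) (fderiv ℝ Φ y v) (fderiv ℝ Φ y w)
          + G (Φ y) (fderiv ℝ (fderiv ℝ Φ) y u v) (fderiv ℝ Φ y w)
          + G (Φ y) (fderiv ℝ Φ y v) (fderiv ℝ (fderiv ℝ Φ) y u w) := by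
      intro u v w
      have h1 := (((hG.differentiableAt (hmaps hy)).hasFDerivAt.comp y hΦd).clm_apply
        (hΦ'd.clm_apply (hasFDerivAt_const v y))).clm_apply
          (hΦ'd.clm_apply (hasFDerivAt_const w y))
      have h2 := ((hG'.differentiableAt hy).hasFDerivAt.clm_apply
        (hasFDerivAt_const v y)).clm_apply (hasFDerivAt_const w y)
      have h3 : (fun z => G' z v w) =ᶠ[𝓝 y]
          fun z => G (Φ z) (fderiv ℝ Φ z v) (fderiv ℝ Φ z w) := by
        filter_upwards [hG'.mem_nhds hy] with z hz using hiso z hz v w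
      have h4 := congrArg (fun L => L u) (h2.unique (h1.congr_of_eventuallyEq h3))
      simp at h4
      rw [h4]
      ring
    intro u v
    refine hG.ext (hmaps hy) fun w => ?_
    obtain ⟨w, rfl⟩ := (hbij y hy).2 w
    rw [← hiso y hy, hG'.apply_christoffel hy, map_add, add_apply,
      hG.apply_christoffel (hmaps hy), hDG, hDG, hDG, hs.eq v u, hs.eq w u, hs.eq w v,
      hG.symm _ (hmaps hy) (fderiv ℝ Φ y v), hG.symm _ (hmaps hy) (fderiv ℝ Φ y u)]
    ring
  -- dΦ intertwines the two Hessians, so they are conjugate and have equal trace.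
  have hconj : ∀ v, fderiv ℝ Φ y (coordHessian G' (f ∘ Φ) y v)
      = coordHessian G f (Φ y) (fderiv ℝ Φ y v) := by
    intro v
    have h1 := hΦ'd.clm_apply
      (hG'.hasFDerivAt_of_contDiffOn hy (hG'.contDiffOn_gradient hfΦ))
    have h2 := (hG.hasFDerivAt_of_contDiffOn (hmaps hy) (hG.contDiffOn_gradient hf)).comp y hΦd
    have h3 := congrArg (fun L => L v) (h1.unique (h2.congr_of_eventuallyEq hgrad))
    simp only [add_apply, ContinuousLinearMap.comp_apply, ContinuousLinearMap.flip_apply] at h3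
    simp only [coordHessian, covDeriv_apply, map_add]
    rw [← h3, hΓ, hgrad.eq_of_nhds]
    abel
  let e : E ≃ₗ[ℝ] E := LinearEquiv.ofBijective (fderiv ℝ Φ y : E →ₗ[ℝ] E) (hbij y hy)
  have he : (coordHessian G f (Φ y) : E →ₗ[ℝ] E)
      = e.conj (coordHessian G' (f ∘ Φ) y : E →ₗ[ℝ] E) := by
    ext w
    obtain ⟨v, rfl⟩ := e.surjective w
    simp only [LinearEquiv.conj_apply_apply, LinearEquiv.symm_apply_apply]
    exact (hconj v).symm
  rw [coordLaplacian_eq, coordLaplacian_eq, traceCLM_apply, traceCLM_apply, he,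
    LinearMap.trace_conj']

end IsMetricOn

end Coordinates

/-! ### Time-dependent functions and the evolution inequality -/

section SpaceTime

variable {E : Type*} [NormedAddCommGroup E] [NormedSpace ℝ E]
  {F : Type*} [NormedAddCommGroup F] [NormedSpace ℝ F]
  {U : Set E} {J : Set ℝ} {u : E → ℝ → F} {y : E} {t : ℝ}

theorem contDiffOn_space_slice (hu : ContDiffOn ℝ ∞ (fun p : E × ℝ => u p.1 p.2) (U ×ˢ J))
    (ht : t ∈ J) : ContDiffOn ℝ ∞ (fun y => u y t) U :=
  hu.comp (contDiff_id.prodMk contDiff_const).contDiffOn fun _ hy => ⟨hy, ht⟩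

theorem contDiffOn_time_slice (hu : ContDiffOn ℝ ∞ (fun p : E × ℝ => u p.1 p.2) (U ×ˢ J))
    (hy : y ∈ U) : ContDiffOn ℝ ∞ (fun t => u y t) J :=
  hu.comp (contDiff_const.prodMk contDiff_id).contDiffOn fun _ ht => ⟨hy, ht⟩

theorem hasFDerivAt_of_contDiffOn_prod (hU : IsOpen U) (hJ : IsOpen J)
    (hu : ContDiffOn ℝ ∞ (fun p : E × ℝ => u p.1 p.2) (U ×ˢ J)) (hy : y ∈ U) (ht : t ∈ J) :
    HasFDerivAt (fun p : E × ℝ => u p.1 p.2) (fderiv ℝ (fun p : E × ℝ => u p.1 p.2) (y, t))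
      (y, t) :=
  ((hu.contDiffAt ((hU.prod hJ).mem_nhds ⟨hy, ht⟩)).differentiableAt (by simp)).hasFDerivAt

theorem fderiv_space_slice (hU : IsOpen U) (hJ : IsOpen J)
    (hu : ContDiffOn ℝ ∞ (fun p : E × ℝ => u p.1 p.2) (U ×ˢ J)) (hy : y ∈ U) (ht : t ∈ J) :
    fderiv ℝ (fun z => u z t) y
      = (fderiv ℝ (fun p : E × ℝ => u p.1 p.2) (y, t)).comp (ContinuousLinearMap.inl ℝ E ℝ) :=
  HasFDerivAt.fderiv <| HasFDerivAt.comp (g := fun p : E × ℝ => u p.1 p.2)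
    (f := fun e : E => (e, t)) y (hasFDerivAt_of_contDiffOn_prod hU hJ hu hy ht) (hasFDerivAt_prodMk_left y t)

theorem deriv_time_slice (hU : IsOpen U) (hJ : IsOpen J)
    (hu : ContDiffOn ℝ ∞ (fun p : E × ℝ => u p.1 p.2) (U ×ˢ J)) (hy : y ∈ U) (ht : t ∈ J) :
    deriv (fun s => u y s) t = fderiv ℝ (fun p : E × ℝ => u p.1 p.2) (y, t) (0, 1) := by
  have h := (hasFDerivAt_of_contDiffOn_prod hU hJ hu hy ht).comp_hasDerivAt t
    ((hasDerivAt_const t y).prodMk (hasDerivAt_id t))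
  exact h.deriv

theorem hasDerivAt_time_slice (hJ : IsOpen J)
    (hu : ContDiffOn ℝ ∞ (fun p : E × ℝ => u p.1 p.2) (U ×ˢ J)) (hy : y ∈ U) (ht : t ∈ J) :
    HasDerivAt (fun s => u y s) (deriv (fun s => u y s) t) t :=
  (((contDiffOn_time_slice hu hy).contDiffAt (hJ.mem_nhds ht)).differentiableAt
    (by simp)).hasDerivAt

theorem contDiffOn_fderiv_space (hU : IsOpen U) (hJ : IsOpen J)
    (hu : ContDiffOn ℝ ∞ (fun p : E × ℝ => u p.1 p.2) (U ×ˢ J)) :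
    ContDiffOn ℝ ∞ (fun p : E × ℝ => fderiv ℝ (fun z => u z p.2) p.1) (U ×ˢ J) :=
  ((hu.fderiv_of_isOpen (hU.prod hJ) (m := ∞) (by simp)).clm_comp contDiffOn_const).congr
    fun _ hp => fderiv_space_slice hU hJ hu hp.1 hp.2

/-- Time and space derivatives commute. -/
theorem hasDerivAt_fderiv_space (hU : IsOpen U) (hJ : IsOpen J)
    (hu : ContDiffOn ℝ ∞ (fun p : E × ℝ => u p.1 p.2) (U ×ˢ J)) (hy : y ∈ U) (ht : t ∈ J) :
    HasDerivAt (fun s => fderiv ℝ (fun z => u z s) y)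
      (fderiv ℝ (fun z => deriv (fun s => u z s) t) y) t := by
  set w : E × ℝ → F := fun p => u p.1 p.2 with hw
  have hs : IsSymmSndFDerivAt ℝ w (y, t) :=
    (hu.contDiffAt ((hU.prod hJ).mem_nhds ⟨hy, ht⟩)).isSymmSndFDerivAt
      (by simpa using two_le_infty)
  have hD : HasFDerivAt (fderiv ℝ w) (fderiv ℝ (fderiv ℝ w) (y, t)) (y, t) :=
    (((hu.fderiv_of_isOpen (hU.prod hJ) (m := ∞) (by simp)).contDiffAt
      ((hU.prod hJ).mem_nhds ⟨hy, ht⟩)).differentiableAt (by simp)).hasFDerivAt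
  have h1 : HasDerivAt (fun s => fderiv ℝ w (y, s)) (fderiv ℝ (fderiv ℝ w) (y, t) (0, 1)) t :=
    hD.comp_hasDerivAt t ((hasDerivAt_const t y).prodMk (hasDerivAt_id t))
  have h2 : HasDerivAt (fun s => (fderiv ℝ w (y, s)).comp (ContinuousLinearMap.inl ℝ E ℝ))
      ((fderiv ℝ (fderiv ℝ w) (y, t) (0, 1)).comp (ContinuousLinearMap.inl ℝ E ℝ)) t :=
    ((ContinuousLinearMap.compL ℝ E (E × ℝ) F).flip
      (ContinuousLinearMap.inl ℝ E ℝ)).hasFDerivAt.comp_hasDerivAt t h1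
  have h3 : HasFDerivAt (fun z => fderiv ℝ w (z, t))
      ((fderiv ℝ (fderiv ℝ w) (y, t)).comp (ContinuousLinearMap.inl ℝ E ℝ)) y :=
    hD.comp y (hasFDerivAt_prodMk_left y t)
  have h4 : HasFDerivAt (fun z => fderiv ℝ w (z, t) (0, 1))
      ((ContinuousLinearMap.apply ℝ F ((0, 1) : E × ℝ)).comp
        ((fderiv ℝ (fderiv ℝ w) (y, t)).comp (ContinuousLinearMap.inl ℝ E ℝ))) y :=
    (ContinuousLinearMap.apply ℝ F ((0, 1) : E × ℝ)).hasFDerivAt.comp y h3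
  have h5 : (fun z => deriv (fun s => u z s) t) =ᶠ[𝓝 y] fun z => fderiv ℝ w (z, t) (0, 1) := by
    filter_upwards [hU.mem_nhds hy] with z hz using deriv_time_slice hU hJ hu hz ht
  have h6 : (fun s => fderiv ℝ (fun z => u z s) y) =ᶠ[𝓝 t]
      fun s => (fderiv ℝ w (y, s)).comp (ContinuousLinearMap.inl ℝ E ℝ) := by
    filter_upwards [hJ.mem_nhds ht] with s hs using fderiv_space_slice hU hJ hu hy hs
  have h7 := h2.congr_of_eventuallyEq h6
  rw [h5.fderiv_eq, h4.fderiv]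
  refine h7.congr_deriv ?_
  ext v
  exact hs.eq (0, 1) (v, 0)

namespace IsMetricOn

variable {G : E → E →L[ℝ] E →L[ℝ] ℝ} {f h : E → ℝ → ℝ} {X : E → ℝ → E}

theorem hasDerivAt_gradient (hG : IsMetricOn G U) (hJ : IsOpen J)
    (hf : ContDiffOn ℝ ∞ (fun p : E × ℝ => f p.1 p.2) (U ×ˢ J)) (hy : y ∈ U) (ht : t ∈ J) :
    HasDerivAt (fun s => coordGradient G (fun z => f z s) y)
      (coordGradient G (fun z => deriv (fun s => f z s) t) y) t :=
  (G y).inverse.hasFDerivAt.comp_hasDerivAt t (hasDerivAt_fderiv_space hG.isOpen hJ hf hy ht)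

variable [FiniteDimensional ℝ E]

theorem contDiffOn_gradient_prod (hG : IsMetricOn G U) (hJ : IsOpen J)
    (hf : ContDiffOn ℝ ∞ (fun p : E × ℝ => f p.1 p.2) (U ×ˢ J)) :
    ContDiffOn ℝ ∞ (fun p : E × ℝ => coordGradient G (fun z => f z p.2) p.1) (U ×ˢ J) :=
  (hG.contDiffOn_inverse.comp contDiffOn_fst fun _ hp => hp.1).clm_apply
    (contDiffOn_fderiv_space hG.isOpen hJ hf)

theorem contDiffOn_covDeriv_prod (hG : IsMetricOn G U) (hJ : IsOpen J)
    (hX : ContDiffOn ℝ ∞ (fun p : E × ℝ => X p.1 p.2) (U ×ˢ J)) :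
    ContDiffOn ℝ ∞ (fun p : E × ℝ => covDeriv G (fun z => X z p.2) p.1) (U ×ˢ J) := by
  have hflip : ContDiffOn ℝ ∞ (fun y => (christoffel G y).flip) U :=
    (ContinuousLinearMap.flipₗᵢ ℝ E E E).contDiff.comp_contDiffOn hG.contDiffOn_christoffel
  exact (contDiffOn_fderiv_space hG.isOpen hJ hX).add
    ((hflip.comp contDiffOn_fst fun _ hp => hp.1).clm_apply hX)

theorem contDiffOn_laplacian_prod (hG : IsMetricOn G U) (hJ : IsOpen J)
    (hf : ContDiffOn ℝ ∞ (fun p : E × ℝ => f p.1 p.2) (U ×ˢ J)) :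
    ContDiffOn ℝ ∞ (fun p : E × ℝ => coordLaplacian G (fun z => f z p.2) p.1) (U ×ˢ J) :=
  (traceCLM E).contDiff.comp_contDiffOn (hG.contDiffOn_covDeriv_prod hJ
    (X := fun y t => coordGradient G (fun z => f z t) y) (hG.contDiffOn_gradient_prod hJ hf))

theorem contDiffOn_gradInner_prod (hG : IsMetricOn G U) (hJ : IsOpen J)
    (hf : ContDiffOn ℝ ∞ (fun p : E × ℝ => f p.1 p.2) (U ×ˢ J))
    (hh : ContDiffOn ℝ ∞ (fun p : E × ℝ => h p.1 p.2) (U ×ˢ J)) :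
    ContDiffOn ℝ ∞ (fun p : E × ℝ => coordGradInner G (fun z => f z p.2) (fun z => h z p.2) p.1)
      (U ×ˢ J) :=
  ((hG.smooth.comp contDiffOn_fst fun _ hp => hp.1).clm_apply
    (hG.contDiffOn_gradient_prod hJ hf)).clm_apply (hG.contDiffOn_gradient_prod hJ hh)

/-- The metric does not depend on time, so the time derivative passes through the gradient, the
covariant derivative and the trace in turn. -/
theorem hasDerivAt_laplacian (hG : IsMetricOn G U) (hJ : IsOpen J)
    (hf : ContDiffOn ℝ ∞ (fun p : E × ℝ => f p.1 p.2) (U ×ˢ J)) (hy : y ∈ U) (ht : t ∈ J) :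
    HasDerivAt (fun s => coordLaplacian G (fun z => f z s) y)
      (coordLaplacian G (fun z => deriv (fun s => f z s) t) y) t := by
  have h1 := hasDerivAt_fderiv_space hG.isOpen hJ
    (u := fun y t => coordGradient G (fun z => f z t) y) (hG.contDiffOn_gradient_prod hJ hf) hy ht
  have h2 : (fun z => deriv (fun s => coordGradient G (fun z => f z s) z) t) =ᶠ[𝓝 y]
      coordGradient G (fun z => deriv (fun s => f z s) t) := by
    filter_upwards [hG.mem_nhds hy] with z hz using (hG.hasDerivAt_gradient hJ hf hz ht).deriv
  rw [h2.fderiv_eq] at h1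
  have h3 := h1.add ((christoffel G y).flip.hasFDerivAt.comp_hasDerivAt t
    (hG.hasDerivAt_gradient hJ hf hy ht))
  exact (traceCLM E).hasFDerivAt.comp_hasDerivAt t h3

theorem hasDerivAt_gradInner_self (hG : IsMetricOn G U) (hJ : IsOpen J)
    (hf : ContDiffOn ℝ ∞ (fun p : E × ℝ => f p.1 p.2) (U ×ˢ J)) (hy : y ∈ U) (ht : t ∈ J) :
    HasDerivAt (fun s => coordGradInner G (fun z => f z s) (fun z => f z s) y)
      (2 * fderiv ℝ (fun z => deriv (fun s => f z s) t) y (coordGradient G (fun z => f z t) y))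
      t := by
  have h1 := hG.hasDerivAt_gradient hJ hf hy ht
  have h2 : HasDerivAt (fun s => G y (coordGradient G (fun z => f z s) y))
      (G y (coordGradient G (fun z => deriv (fun s => f z s) t) y)) t :=
    (G y).hasFDerivAt.comp_hasDerivAt t h1
  refine (h2.clm_apply h1).congr_deriv ?_
  rw [hG.symm y hy (coordGradient G (fun z => f z t) y), hG.apply_gradient hy]
  ring

/-- The Cauchy-Schwarz inequality for the trace of `A + c X ⊗ X♭`. -/
theorem sq_trace_add_le (hG : IsMetricOn G U) (hy : y ∈ U) (A : E →L[ℝ] E)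
    (hA : ∀ v w, G y (A v) w = G y v (A w)) (X : E) (c : ℝ) :
    (traceCLM E A + c * G y X X) ^ 2 ≤ Module.finrank ℝ E *
      (traceCLM E (A.comp A) + 2 * c * G y (A X) X + c ^ 2 * G y X X ^ 2) := by
  set R : E →L[ℝ] E := (G y X).smulRight X with hR
  have h := sq_trace_le_finrank_mul_trace_sq (form G y) (hG.symm y hy) (hG.pos y hy)
    ((A + c • R : E →L[ℝ] E) : E →ₗ[ℝ] E) (fun v w => by
      simp only [form_apply, hR, ContinuousLinearMap.coe_coe, add_apply, smul_apply,
        ContinuousLinearMap.smulRight_apply, map_add (G y), map_add (G y v), map_smul (G y),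
        map_smul (G y v), hA, smul_eq_mul]
      rw [hG.symm y hy v X]
      ring)
  have h1 : LinearMap.trace ℝ E ((A + c • R : E →L[ℝ] E) : E →ₗ[ℝ] E)
      = traceCLM E A + c * G y X X := by
    rw [← traceCLM_apply, map_add, map_smul, hR, traceCLM_smulRight, smul_eq_mul]
  have h2 : LinearMap.trace ℝ E (((A + c • R : E →L[ℝ] E) : E →ₗ[ℝ] E) ∘ₗ
      ((A + c • R : E →L[ℝ] E) : E →ₗ[ℝ] E))
      = traceCLM E (A.comp A) + 2 * c * G y (A X) X + c ^ 2 * G y X X ^ 2 := by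
    have h3 : (A + c • R).comp (A + c • R) = A.comp A + c • (A.comp R + R.comp A)
        + c ^ 2 • (G y X X) • R := by
      ext v
      simp only [hR, add_apply, smul_apply, ContinuousLinearMap.comp_apply,
        ContinuousLinearMap.smulRight_apply, map_add, map_smul]
      module
    have h4 : traceCLM E (R.comp A) = G y (A X) X := by
      have : R.comp A = ((G y X).comp A).smulRight X := by ext v; simp [hR]
      rw [this, traceCLM_smulRight, ContinuousLinearMap.comp_apply, hA]
    change traceCLM E ((A + c • R).comp (A + c • R)) = _
    rw [h3, map_add, map_add, map_smul,
      map_smul, map_smul, map_add, traceCLM_comp_comm A R, h4, hR, traceCLM_smulRight]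
    simp only [smul_eq_mul]
    ring
  rw [h1, h2] at h
  exact h

/-- The differential inequality satisfied by `Δf - |∇θ|²` at a spatial minimum. -/
theorem evolution_inequality (hG : IsMetricOn G U) (hJ : IsOpen J) {a κ : ℝ} {θ : E → ℝ → ℝ}
    (hf : ContDiffOn ℝ ∞ (fun p : E × ℝ => f p.1 p.2) (U ×ˢ J))
    (hθ : ContDiffOn ℝ ∞ (fun p : E × ℝ => θ p.1 p.2) (U ×ˢ J))
    (hθ0 : ∀ y ∈ U, ∀ t ∈ J, 0 < θ y t ∧ θ y t < Real.pi / 2)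
    (hfeq : ∀ y ∈ U, ∀ t ∈ J, deriv (fun s => f y s) t = coordLaplacian G (fun z => f z t) y
      + coordGradInner G (fun z => f z t) (fun z => f z t) y + a * f y t)
    (hθeq : ∀ y ∈ U, ∀ t ∈ J, deriv (fun s => θ y s) t = coordLaplacian G (fun z => θ z t) y
      - Real.tan (θ y t) * coordGradInner G (fun z => θ z t) (fun z => θ z t) y
      + 2 * coordGradInner G (fun z => θ z t) (fun z => f z t) y
      + a * (Real.tan (θ y t) * Real.log (Real.sin (θ y t))))
    (hy : y ∈ U) (ht : t ∈ J) (hκ : 0 ≤ κ)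
    (hric : ∀ v, κ * G y v v ≤ coordRicci G y v v)
    (haκ : a * (1 + 2 * Real.log (Real.sin (θ y t)) / Real.cos (θ y t) ^ 2) ≤ 2 * κ)
    (hmin : IsLocalMin (fun z => coordLaplacian G (fun z => f z t) z
      - coordGradInner G (fun z => θ z t) (fun z => θ z t) z) y) :
    ∃ d, HasDerivAt (fun s => coordLaplacian G (fun z => f z s) y
      - coordGradInner G (fun z => θ z s) (fun z => θ z s) y) d t ∧
      2 * (coordLaplacian G (fun z => f z t) y
          - coordGradInner G (fun z => θ z t) (fun z => θ z t) y) ^ 2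
        ≤ Module.finrank ℝ E * (d - a * (coordLaplacian G (fun z => f z t) y
          - coordGradInner G (fun z => θ z t) (fun z => θ z t) y)) := by
  -- The witness is d = Δ(f_t) - 2 dθ_t(∇θ).
  refine ⟨_, (hG.hasDerivAt_laplacian hJ hf hy ht).sub
    (hG.hasDerivAt_gradInner_self hJ hθ hy ht), ?_⟩
  have hfs := contDiffOn_space_slice hf ht
  have hθs := contDiffOn_space_slice hθ ht
  obtain ⟨f₀, hf₀⟩ : ∃ f₀ : E → ℝ, f₀ = fun z => f z t := ⟨_, rfl⟩
  obtain ⟨θ₀, hθ₀⟩ : ∃ θ₀ : E → ℝ, θ₀ = fun z => θ z t := ⟨_, rfl⟩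
  have hft : (fun z => deriv (fun s => f z s) t) =ᶠ[𝓝 y]
      fun z => coordLaplacian G f₀ z + coordGradInner G f₀ f₀ z + a * f₀ z := by
    filter_upwards [hG.mem_nhds hy] with z hz
    rw [hf₀]; exact hfeq z hz t ht
  have hθt : (fun z => deriv (fun s => θ z s) t) =ᶠ[𝓝 y] fun z => coordLaplacian G θ₀ z
      - Real.tan (θ₀ z) * coordGradInner G θ₀ θ₀ z + 2 * coordGradInner G θ₀ f₀ z
      + a * (Real.tan (θ₀ z) * Real.log (Real.sin (θ₀ z))) := by
    filter_upwards [hG.mem_nhds hy] with z hz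
    rw [hf₀, hθ₀]; exact hθeq z hz t ht
  have hθy : 0 < θ₀ y ∧ θ₀ y < Real.pi / 2 := by rw [hθ₀]; exact hθ0 y hy t ht
  have haκ' : a * (1 + 2 * Real.log (Real.sin (θ₀ y)) / Real.cos (θ₀ y) ^ 2) ≤ 2 * κ := by
    rw [hθ₀]; exact haκ
  rw [coordLaplacian_congr hft, hθt.fderiv_eq]
  rw [← hf₀] at hfs hmin ⊢
  rw [← hθ₀] at hθs hmin ⊢
  clear hf₀ hθ₀ hft hθt hfeq hθeq hf hθ haκ
  have hLf := hG.contDiffOn_laplacian hfs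
  have hLθ := hG.contDiffOn_laplacian hθs
  have hPf := hG.contDiffOn_gradInner hfs hfs
  have hPθ := hG.contDiffOn_gradInner hθs hθs
  have hPθf := hG.contDiffOn_gradInner hθs hfs
  obtain ⟨X, hX⟩ : ∃ X, X = coordGradient G θ₀ y := ⟨_, rfl⟩
  obtain ⟨A, hA⟩ : ∃ A, A = coordHessian G θ₀ y := ⟨_, rfl⟩
  obtain ⟨Z, hZ⟩ : ∃ Z, Z = coordGradient G f₀ y := ⟨_, rfl⟩
  obtain ⟨H, hH⟩ : ∃ H, H = coordHessian G f₀ y := ⟨_, rfl⟩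
  have hsin : 0 < Real.sin (θ₀ y) := Real.sin_pos_of_pos_of_lt_pi hθy.1 (by linarith [Real.pi_pos])
  have hcos : 0 < Real.cos (θ₀ y) := Real.cos_pos_of_mem_Ioo ⟨by linarith, hθy.2⟩
  -- The Laplacian of the time derivative of `f`
  have hlap : coordLaplacian G
      (fun z => coordLaplacian G f₀ z + coordGradInner G f₀ f₀ z + a * f₀ z) y
      = coordLaplacian G (coordLaplacian G f₀) y + coordLaplacian G (coordGradInner G f₀ f₀) y
        + a * coordLaplacian G f₀ y := by
    rw [hG.laplacian_add (hLf.add hPf) (contDiffOn_const.mul hfs) hy,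
      hG.laplacian_add hLf hPf hy, hG.laplacian_const_mul hfs hy]
  -- The differential of the time derivative of `θ`
  have hθd : HasFDerivAt θ₀ (fderiv ℝ θ₀ y) y := hG.hasFDerivAt_of_contDiffOn hy hθs
  have htan : HasFDerivAt (fun z => Real.tan (θ₀ z))
      ((1 / Real.cos (θ₀ y) ^ 2) • fderiv ℝ θ₀ y) y :=
    (Real.hasDerivAt_tan hcos.ne').comp_hasFDerivAt y hθd
  have hlog : HasFDerivAt (fun z => Real.log (Real.sin (θ₀ z)))
      ((Real.cos (θ₀ y) / Real.sin (θ₀ y)) • fderiv ℝ θ₀ y) y :=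
    ((Real.hasDerivAt_sin _).log hsin.ne').comp_hasFDerivAt y hθd
  have hdθ := ((((hG.hasFDerivAt_of_contDiffOn hy hLθ).sub
    (htan.mul (hG.hasFDerivAt_of_contDiffOn hy hPθ))).add
      ((hG.hasFDerivAt_of_contDiffOn hy hPθf).const_mul 2)).add
        ((htan.mul hlog).const_mul a)).fderiv
  have hdθ' : fderiv ℝ (fun z => coordLaplacian G θ₀ z
      - Real.tan (θ₀ z) * coordGradInner G θ₀ θ₀ z + 2 * coordGradInner G θ₀ f₀ z
      + a * (Real.tan (θ₀ z) * Real.log (Real.sin (θ₀ z)))) y X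
      = fderiv ℝ (coordLaplacian G θ₀) y X
        - (2 * Real.tan (θ₀ y) * G y (A X) X + G y X X * (1 / Real.cos (θ₀ y) ^ 2 * G y X X))
        + 2 * (G y (A X) Z + G y (H X) X)
        + a * (1 + Real.log (Real.sin (θ₀ y)) / Real.cos (θ₀ y) ^ 2) * G y X X := by
    have h1 : fderiv ℝ θ₀ y X = G y X X := by rw [hX, hG.apply_gradient hy]
    have h2 : G y (A Z) X = G y (A X) Z := by
      rw [hA, hG.hessian_symm hθs hy, hG.symm y hy]
    have h3 : Real.tan (θ₀ y) * (Real.cos (θ₀ y) / Real.sin (θ₀ y)) = 1 := by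
      rw [Real.tan_eq_sin_div_cos]; field_simp
    refine (congrArg (fun L => L X) hdθ).trans ?_
    simp only [add_apply, sub_apply, smul_apply, smul_eq_mul, h1, hG.fderiv_gradInner hθs hθs hy,
      hG.fderiv_gradInner hθs hfs hy, ← hX, ← hA, ← hZ, ← hH, h2]
    rw [show coordGradInner G θ₀ θ₀ y = G y X X by rw [hX]; rfl]
    linear_combination (a * G y X X) * h3
  -- The conditions at the minimum
  have hmin0 := hmin.fderiv_eq_zero
  -- dQ = 0 says dΔf = d|∇θ|². In Bochner's formula for f this produces 4⟨A X, Z⟩, which cancels the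
  -- same term coming from 2⟨∇θ, ∇f⟩ in θ_t.
  have hdP : fderiv ℝ (coordLaplacian G f₀) y Z = 2 * G y (A X) Z := by
    have h1 : fderiv ℝ (fun z => coordLaplacian G f₀ z - coordGradInner G θ₀ θ₀ z) y
        = _ := ((hG.hasFDerivAt_of_contDiffOn hy hLf).sub
          (hG.hasFDerivAt_of_contDiffOn hy hPθ)).fderiv
    rw [hmin0] at h1
    have h2 := congrArg (fun L => L Z) h1
    simp only [zero_apply, sub_apply, hG.fderiv_gradInner hθs hθs hy, ← hX, ← hA] at h2
    linarith
  -- ΔQ ≥ 0 replaces ΔΔf by Δ|∇θ|², which brings in Bochner's formula for θ.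
  have hlapF : 0 ≤ coordLaplacian G (coordLaplacian G f₀) y
      - coordLaplacian G (coordGradInner G θ₀ θ₀) y := by
    have h1 := hG.laplacian_nonneg_of_isLocalMin (hLf.sub hPθ) hy hmin
    have h2 : (fun z => coordLaplacian G f₀ z - coordGradInner G θ₀ θ₀ z)
        = fun z => coordLaplacian G f₀ z + (-1) * coordGradInner G θ₀ θ₀ z := by
      funext z; ring
    rw [h2, hG.laplacian_add hLf (contDiffOn_const.mul hPθ) hy,
      hG.laplacian_const_mul hPθ hy] at h1
    linarith
  have hBf := hG.laplacian_gradInner_self hfs hy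
  have hBθ := hG.laplacian_gradInner_self hθs hy
  -- The coefficients -1 and tan θ are those that absorb the cross terms -4⟨H X, X⟩ and 4 tan θ ⟨A
  -- X, X⟩. With -1 the trace is Δf - |∇θ|² = Q.
  have hCf := hG.sq_trace_add_le hy H (by rw [hH]; exact hG.hessian_symm hfs hy) X (-1)
  have hCθ := hG.sq_trace_add_le hy A (by rw [hA]; exact hG.hessian_symm hθs hy) X
    (Real.tan (θ₀ y))
  -- Along ∇θ the full bound κ is needed to offset the zeroth-order term; along ∇f only Ric ≥ 0 is
  -- used.
  have hRX := hric X
  have hRZ := (mul_nonneg hκ (hG.nonneg hy Z)).trans (hric Z)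
  have haX := mul_le_mul_of_nonneg_right haκ' (hG.nonneg hy X)
  -- Splits the quartic term 2 sec²θ |∇θ|⁴ into the parts 2|∇θ|⁴ and 2 tan²θ |∇θ|⁴ that complete the
  -- two squares.
  have hsec : 1 / Real.cos (θ₀ y) ^ 2 = 1 + Real.tan (θ₀ y) ^ 2 := by
    rw [Real.tan_eq_sin_div_cos, div_pow, eq_comm]
    field_simp
    linarith [Real.sin_sq_add_cos_sq (θ₀ y)]
  rw [coordLaplacian_eq G f₀, show coordGradInner G θ₀ θ₀ y = G y X X by rw [hX]; rfl, hlap, ← hX,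
    hdθ', ← hH]
  rw [← hA, ← hX] at hBθ
  rw [← hH, ← hZ, hdP] at hBf
  rw [coordLaplacian_eq G f₀, ← hH, hsec]
  -- The two completed squares are bounded by d - aQ. After subtracting aQ the zeroth-order terms
  -- amount to -a(1 + 2 ln sin θ/cos²θ)|∇θ|², offset by 2κ|∇θ|².
  have key : 2 * (traceCLM E (A.comp A) + 2 * Real.tan (θ₀ y) * G y (A X) X
        + Real.tan (θ₀ y) ^ 2 * G y X X ^ 2)
      + 2 * (traceCLM E (H.comp H) + 2 * -1 * G y (H X) X + (-1) ^ 2 * G y X X ^ 2)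
      ≤ coordLaplacian G (coordLaplacian G f₀) y + coordLaplacian G (coordGradInner G f₀ f₀) y
        + a * traceCLM E H - 2 * (fderiv ℝ (coordLaplacian G θ₀) y X
        - (2 * Real.tan (θ₀ y) * G y (A X) X + G y X X * ((1 + Real.tan (θ₀ y) ^ 2) * G y X X))
        + 2 * (G y (A X) Z + G y (H X) X)
        + a * (1 + Real.log (Real.sin (θ₀ y)) / Real.cos (θ₀ y) ^ 2) * G y X X)
        - a * (traceCLM E H - G y X X) := by
    rw [mul_div_assoc] at haX
    linarith
  have hn : (0 : ℝ) ≤ Module.finrank ℝ E := Nat.cast_nonneg _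
  have := mul_le_mul_of_nonneg_left key hn
  -- Only the nonnegativity of the squared trace in `hCθ` is kept; `hCf` supplies Q².
  nlinarith [sq_nonneg (traceCLM E A + Real.tan (θ₀ y) * G y X X)]

end IsMetricOn

end SpaceTime

/-! ### Elementary bounds for (ln h)/(1 - h²) -/

/-- `(ln h) / (1 - h²) ≤ -1/2` for `0 < h < 1`. -/
theorem log_div_one_sub_sq_le {h : ℝ} (h0 : 0 < h) (h1 : h < 1) :
    Real.log h / (1 - h ^ 2) ≤ -(1 / 2) := by
  have hp : 0 < 1 - h ^ 2 := by nlinarith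
  rw [div_le_iff₀ hp]
  have := Real.log_le_sub_one_of_pos (pow_pos h0 2)
  rw [Real.log_pow] at this
  push_cast at this
  linarith

/-- `(ln h) / (1 - h²)` is nondecreasing in `h` on `(0, 1)`. -/
theorem log_div_one_sub_sq_mono {c h : ℝ} (c0 : 0 < c) (hc : c < h) (h1 : h < 1) :
    Real.log c / (1 - c ^ 2) ≤ Real.log h / (1 - h ^ 2) := by
  have h0 : 0 < h := c0.trans hc
  have hph : 0 < 1 - h ^ 2 := by nlinarith
  have hpc : 0 < 1 - c ^ 2 := by nlinarith
  have hle : 1 - h ^ 2 ≤ 1 - c ^ 2 := by nlinarith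
  -- Chord inequality for the logarithm between c² and 1, with weights chosen so that the
  -- intermediate point is h².
  have hconc := strictConcaveOn_log_Ioi.concaveOn.2 (Set.mem_Ioi.2 (pow_pos c0 2))
    (Set.mem_Ioi.2 one_pos) (show 0 ≤ (1 - h ^ 2) / (1 - c ^ 2) by positivity)
    (show 0 ≤ 1 - (1 - h ^ 2) / (1 - c ^ 2) by rw [sub_nonneg, div_le_one hpc]; exact hle)
    (by ring)
  have hx : (1 - h ^ 2) / (1 - c ^ 2) * c ^ 2 + (1 - (1 - h ^ 2) / (1 - c ^ 2)) * 1 = h ^ 2 := by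
    field_simp; ring
  simp only [smul_eq_mul, hx, Real.log_one, mul_zero, add_zero, Real.log_pow] at hconc
  push_cast at hconc
  rw [le_div_iff₀ hph]
  calc Real.log c / (1 - c ^ 2) * (1 - h ^ 2) = (1 - h ^ 2) / (1 - c ^ 2) * Real.log c := by ring
    _ ≤ Real.log h := by linarith

/-! ### Pairs of solutions and the angle arcsin(φ/ψ) in coordinates -/

section Coordinates

variable {E : Type*} [NormedAddCommGroup E] [NormedSpace ℝ E]
  {G : E → E →L[ℝ] E →L[ℝ] ℝ} {U : Set E} {J : Set ℝ} {φ ψ u : E → ℝ → ℝ} {y : E} {t a : ℝ}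

/-- `u` is a positive smooth solution of `∂u/∂t = Δu + a u ln u` in coordinates. -/
structure IsCoordSolution (G : E → E →L[ℝ] E →L[ℝ] ℝ) (U : Set E) (J : Set ℝ) (a : ℝ)
    (u : E → ℝ → ℝ) : Prop where
  smooth : ContDiffOn ℝ ∞ (fun p : E × ℝ => u p.1 p.2) (U ×ˢ J)
  pos : ∀ y ∈ U, ∀ t ∈ J, 0 < u y t
  equation : ∀ y ∈ U, ∀ t ∈ J, deriv (fun s => u y s) t
    = coordLaplacian G (fun z => u z t) y + a * u y t * Real.log (u y t)

theorem IsCoordSolution.contDiffOn_log (hu : IsCoordSolution G U J a u) :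
    ContDiffOn ℝ ∞ (fun p : E × ℝ => Real.log (u p.1 p.2)) (U ×ˢ J) :=
  hu.smooth.log fun p hp => (hu.pos p.1 hp.1 p.2 hp.2).ne'

/-- The evolution equation of `ln u`. -/
theorem IsCoordSolution.deriv_log [FiniteDimensional ℝ E] (hG : IsMetricOn G U) (hJ : IsOpen J)
    (hu : IsCoordSolution G U J a u) (hy : y ∈ U) (ht : t ∈ J) :
    deriv (fun s => Real.log (u y s)) t = coordLaplacian G (fun z => Real.log (u z t)) y
      + coordGradInner G (fun z => Real.log (u z t)) (fun z => Real.log (u z t)) y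
      + a * Real.log (u y t) := by
  have hpos := hu.pos y hy t ht
  have hus := contDiffOn_space_slice hu.smooth ht
  have hud := hG.differentiableAt_of_contDiffOn hy hus
  have hlog := Real.hasDerivAt_log hpos.ne'
  have hinv := hasDerivAt_inv hpos.ne'
  rw [((hasDerivAt_time_slice hJ hu.smooth hy ht).log hpos.ne').deriv, hu.equation y hy t ht,
    coordGradInner_comp_left hud hlog, coordGradInner_comp_right hud hlog,
    hG.laplacian_comp hus hy (k := Real.log) (k' := fun s => s⁻¹)
      ((eventually_ne_nhds hpos.ne').mono fun s hs => Real.hasDerivAt_log hs) hinv]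
  field_simp
  ring

/-- `arcsin (φ / ψ)`. -/
noncomputable def quotAngle (φ ψ : E → ℝ → ℝ) (y : E) (t : ℝ) : ℝ := Real.arcsin (φ y t / ψ y t)

variable (hφ : IsCoordSolution G U J a φ)
  (hψ : IsCoordSolution G U J a ψ) (hlt : ∀ y ∈ U, ∀ t ∈ J, φ y t < ψ y t)

include hφ hψ hlt

theorem quot_mem_Ioo (hy : y ∈ U) (ht : t ∈ J) : φ y t / ψ y t ∈ Set.Ioo (0 : ℝ) 1 :=
  ⟨div_pos (hφ.pos y hy t ht) (hψ.pos y hy t ht),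
    (div_lt_one (hψ.pos y hy t ht)).2 (hlt y hy t ht)⟩

theorem quotAngle_mem_Ioo (hy : y ∈ U) (ht : t ∈ J) :
    0 < quotAngle φ ψ y t ∧ quotAngle φ ψ y t < Real.pi / 2 := by
  have h := quot_mem_Ioo hφ hψ hlt hy ht
  exact ⟨Real.arcsin_pos.2 h.1, Real.arcsin_lt_pi_div_two.2 h.2⟩

theorem sin_quotAngle (hy : y ∈ U) (ht : t ∈ J) :
    Real.sin (quotAngle φ ψ y t) = φ y t / ψ y t := by
  have h := quot_mem_Ioo hφ hψ hlt hy ht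
  exact Real.sin_arcsin (by linarith [h.1]) h.2.le

theorem sin_quotAngle_pos (hy : y ∈ U) (ht : t ∈ J) : 0 < Real.sin (quotAngle φ ψ y t) := by
  rw [sin_quotAngle hφ hψ hlt hy ht]
  exact (quot_mem_Ioo hφ hψ hlt hy ht).1

theorem cos_quotAngle_pos (hy : y ∈ U) (ht : t ∈ J) : 0 < Real.cos (quotAngle φ ψ y t) := by
  have h := quotAngle_mem_Ioo hφ hψ hlt hy ht
  exact Real.cos_pos_of_mem_Ioo ⟨by linarith, h.2⟩

theorem contDiffOn_quotAngle :
    ContDiffOn ℝ ∞ (fun p : E × ℝ => quotAngle φ ψ p.1 p.2) (U ×ˢ J) := by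
  intro p hp
  have h := quot_mem_Ioo hφ hψ hlt hp.1 hp.2
  exact (Real.contDiffAt_arcsin (by linarith [h.1]) h.2.ne).comp_contDiffWithinAt p
    ((hφ.smooth p hp).div (hψ.smooth p hp) (hψ.pos p.1 hp.1 p.2 hp.2).ne')

/-- Additivity here lets the equation of θ be read off as the difference of the equations of ln φ
and ln ψ. -/
theorem log_eq_log_add_log_sin (hy : y ∈ U) (ht : t ∈ J) :
    Real.log (φ y t) = Real.log (ψ y t) + Real.log (Real.sin (quotAngle φ ψ y t)) := by
  rw [sin_quotAngle hφ hψ hlt hy ht,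
    Real.log_div (hφ.pos y hy t ht).ne' (hψ.pos y hy t ht).ne']
  ring

variable (hG : IsMetricOn G U) (hJ : IsOpen J)

include hG

/-- With h = sin θ one has dh = cos θ dθ, and cos²θ = 1 - h² cancels the denominator. This is why
the angle is introduced. -/
theorem gradInner_quot_div (hy : y ∈ U) (ht : t ∈ J) :
    coordGradInner G (fun z => φ z t / ψ z t) (fun z => φ z t / ψ z t) y
        / (1 - (φ y t / ψ y t) ^ 2)
      = coordGradInner G (fun z => quotAngle φ ψ z t) (fun z => quotAngle φ ψ z t) y := by
  have hθd := hG.differentiableAt_of_contDiffOn hy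
    (contDiffOn_space_slice (contDiffOn_quotAngle hφ hψ hlt) ht)
  have h1 : (fun z => φ z t / ψ z t) =ᶠ[𝓝 y] fun z => Real.sin (quotAngle φ ψ z t) := by
    filter_upwards [hG.mem_nhds hy] with z hz using (sin_quotAngle hφ hψ hlt hz ht).symm
  have hcos := cos_quotAngle_pos hφ hψ hlt hy ht
  rw [coordGradInner_congr h1 h1, coordGradInner_comp_left hθd (Real.hasDerivAt_sin _),
    coordGradInner_comp_right hθd (Real.hasDerivAt_sin _), ← sin_quotAngle hφ hψ hlt hy ht,
    ← Real.cos_sq']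
  field_simp

variable [FiniteDimensional ℝ E]

include hJ

/-- The evolution equation of `arcsin (φ / ψ)`. -/
theorem deriv_quotAngle (hy : y ∈ U) (ht : t ∈ J) :
    deriv (fun s => quotAngle φ ψ y s) t = coordLaplacian G (fun z => quotAngle φ ψ z t) y
      - Real.tan (quotAngle φ ψ y t)
        * coordGradInner G (fun z => quotAngle φ ψ z t) (fun z => quotAngle φ ψ z t) y
      + 2 * coordGradInner G (fun z => quotAngle φ ψ z t) (fun z => Real.log (ψ z t)) y
      + a * (Real.tan (quotAngle φ ψ y t) * Real.log (Real.sin (quotAngle φ ψ y t))) := by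
  have hθ := contDiffOn_quotAngle hφ hψ hlt
  have hθs := contDiffOn_space_slice hθ ht
  have hθd := hG.differentiableAt_of_contDiffOn hy hθs
  have hf := hψ.contDiffOn_log
  have hfs : ContDiffOn ℝ ∞ (fun z => Real.log (ψ z t)) U :=
    contDiffOn_space_slice (u := fun z t => Real.log (ψ z t)) hf ht
  have hfd := hG.differentiableAt_of_contDiffOn hy hfs
  have hsin := sin_quotAngle_pos hφ hψ hlt hy ht
  have hcos := cos_quotAngle_pos hφ hψ hlt hy ht
  have hls : ContDiffOn ℝ ∞ (fun z => Real.log (Real.sin (quotAngle φ ψ z t))) U :=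
    (Real.contDiff_sin.comp_contDiffOn hθs).log fun z hz => (sin_quotAngle_pos hφ hψ hlt hz ht).ne'
  have hlsd := hG.differentiableAt_of_contDiffOn hy hls
  have hk : ∀ s, Real.sin s ≠ 0 →
      HasDerivAt (fun s => Real.log (Real.sin s)) (Real.cos s / Real.sin s) s :=
    fun s hs => (Real.hasDerivAt_sin s).log hs
  have hk' := (Real.hasDerivAt_cos (quotAngle φ ψ y t)).div (Real.hasDerivAt_sin _) hsin.ne'
  have hspace : (fun z => Real.log (φ z t)) =ᶠ[𝓝 y]
      fun z => Real.log (ψ z t) + Real.log (Real.sin (quotAngle φ ψ z t)) := by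
    filter_upwards [hG.mem_nhds hy] with z hz using log_eq_log_add_log_sin hφ hψ hlt hz ht
  have htime : (fun s => Real.log (φ y s)) =ᶠ[𝓝 t]
      fun s => Real.log (ψ y s) + Real.log (Real.sin (quotAngle φ ψ y s)) := by
    filter_upwards [hJ.mem_nhds ht] with s hs using log_eq_log_add_log_sin hφ hψ hlt hy hs
  have hdf := hasDerivAt_time_slice (u := fun y t => Real.log (ψ y t)) hJ hf hy ht
  have hdθ := hasDerivAt_time_slice hJ hθ hy ht
  have he := hφ.deriv_log hG hJ hy ht
  have hkθ : HasDerivAt (fun s => Real.log (Real.sin (quotAngle φ ψ y s)))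
      (Real.cos (quotAngle φ ψ y t) / Real.sin (quotAngle φ ψ y t)
        * deriv (fun s => quotAngle φ ψ y s) t) t := (hk _ hsin.ne').comp t hdθ
  have hdsum : deriv (fun s => Real.log (ψ y s) + Real.log (Real.sin (quotAngle φ ψ y s))) t = _ :=
    (hdf.add hkθ).deriv
  rw [htime.deriv_eq, hdsum, hψ.deriv_log hG hJ hy ht, coordLaplacian_congr hspace,
    coordGradInner_congr hspace hspace, hG.laplacian_add hfs hls hy,
    coordGradInner_add_left hfd hlsd, coordGradInner_add_right hfd hlsd,
    coordGradInner_add_right hfd hlsd,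
    coordGradInner_comp_left (k := fun s => Real.log (Real.sin s)) hθd (hk _ hsin.ne'),
    coordGradInner_comp_left (k := fun s => Real.log (Real.sin s)) hθd (hk _ hsin.ne'),
    coordGradInner_comp_right (k := fun s => Real.log (Real.sin s)) hθd (hk _ hsin.ne'),
    coordGradInner_comp_right (k := fun s => Real.log (Real.sin s)) hθd (hk _ hsin.ne'),
    hG.laplacian_comp (k := fun s => Real.log (Real.sin s))
      (k' := fun s => Real.cos s / Real.sin s) hθs hy
      ((Real.continuous_sin.continuousAt.eventually_ne hsin.ne').mono hk) hk',
    log_eq_log_add_log_sin hφ hψ hlt hy ht,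
    hG.gradInner_comm hy (fun z => Real.log (ψ z t)) (fun z => quotAngle φ ψ z t)] at he
  have h1 := Real.sin_sq_add_cos_sq (quotAngle φ ψ y t)
  generalize coordGradInner G (fun z => quotAngle φ ψ z t) (fun z => quotAngle φ ψ z t) y = P at *
  generalize coordGradInner G (fun z => quotAngle φ ψ z t) (fun z => Real.log (ψ z t)) y = Q at *
  generalize coordLaplacian G (fun z => quotAngle φ ψ z t) y = L at *
  generalize deriv (fun s => quotAngle φ ψ y s) t = D at *
  rw [Real.tan_eq_sin_div_cos]
  generalize Real.log (Real.sin (quotAngle φ ψ y t)) = l at *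
  generalize Real.sin (quotAngle φ ψ y t) = S at *
  generalize Real.cos (quotAngle φ ψ y t) = C at *
  -- The difference of the two logarithmic equations. The second derivative -1/sin² of ln sin and
  -- the square cot² of its first derivative add up to -1. Multiplying by tan θ gives the claim.
  have h2 : C / S * D = C / S * L - P + 2 * (C / S) * Q + a * l := by
    have h3 : (-S * S - C * C) / S ^ 2 * P + C / S * (C / S * P) = -P := by
      field_simp
      ring
    linear_combination he + h3
  have hS := hsin.ne'
  have hC := hcos.ne'
  field_simp at h2 ⊢
  linear_combination h2

/-- Joint continuity of `Δ ln ψ - |∇h|² / (1 - h²)`. -/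
theorem continuousOn_harnackQuantity :
    ContinuousOn (fun p : E × ℝ => coordLaplacian G (fun z => Real.log (ψ z p.2)) p.1
      - coordGradInner G (fun z => φ z p.2 / ψ z p.2) (fun z => φ z p.2 / ψ z p.2) p.1
        / (1 - (φ p.1 p.2 / ψ p.1 p.2) ^ 2)) (U ×ˢ J) := by
  have hθ := contDiffOn_quotAngle hφ hψ hlt
  refine ContinuousOn.congr ((hG.contDiffOn_laplacian_prod hJ
    (f := fun z t => Real.log (ψ z t)) hψ.contDiffOn_log).continuousOn.sub
      (hG.contDiffOn_gradInner_prod hJ hθ hθ).continuousOn) fun p hp => ?_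
  rw [gradInner_quot_div hφ hψ hlt hG hp.1 hp.2]
  rfl

/-- The differential inequality satisfied by `Δ ln ψ - |∇h|² / (1 - h²)`, `h = φ / ψ`, at a
spatial minimum. -/
theorem harnackQuantity_inequality {κ : ℝ} (hy : y ∈ U) (ht : t ∈ J) (hκ : 0 ≤ κ)
    (hric : ∀ v, κ * G y v v ≤ coordRicci G y v v)
    (haκ : a * (1 + 2 * Real.log (φ y t / ψ y t) / (1 - (φ y t / ψ y t) ^ 2)) ≤ 2 * κ)
    {Q : E → ℝ → ℝ}
    (hQ : ∀ y ∈ U, ∀ t ∈ J, Q y t = coordLaplacian G (fun z => Real.log (ψ z t)) y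
      - coordGradInner G (fun z => φ z t / ψ z t) (fun z => φ z t / ψ z t) y
        / (1 - (φ y t / ψ y t) ^ 2))
    (hmin : IsLocalMin (fun z => Q z t) y) :
    ∃ d, HasDerivAt (fun s => Q y s) d t ∧
      2 * Q y t ^ 2 ≤ Module.finrank ℝ E * (d - a * Q y t) := by
  have hQ' : ∀ y ∈ U, ∀ t ∈ J, Q y t = coordLaplacian G (fun z => Real.log (ψ z t)) y
      - coordGradInner G (fun z => quotAngle φ ψ z t) (fun z => quotAngle φ ψ z t) y :=
    fun y hy t ht => by rw [hQ y hy t ht, gradInner_quot_div hφ hψ hlt hG hy ht]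
  have hspace : (fun z => Q z t) =ᶠ[𝓝 y] fun z => coordLaplacian G (fun z => Real.log (ψ z t)) z
      - coordGradInner G (fun z => quotAngle φ ψ z t) (fun z => quotAngle φ ψ z t) z := by
    filter_upwards [hG.mem_nhds hy] with z hz using hQ' z hz t ht
  have htime : (fun s => Q y s) =ᶠ[𝓝 t] fun s => coordLaplacian G (fun z => Real.log (ψ z s)) y
      - coordGradInner G (fun z => quotAngle φ ψ z s) (fun z => quotAngle φ ψ z s) y := by
    filter_upwards [hJ.mem_nhds ht] with s hs using hQ' y hy s hs
  obtain ⟨d, hd, hd'⟩ := hG.evolution_inequality hJ (f := fun z t => Real.log (ψ z t))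
    hψ.contDiffOn_log (contDiffOn_quotAngle hφ hψ hlt)
    (fun y hy t ht => quotAngle_mem_Ioo hφ hψ hlt hy ht)
    (fun y hy t ht => hψ.deriv_log hG hJ hy ht)
    (fun y hy t ht => deriv_quotAngle hφ hψ hlt hG hJ hy ht) hy ht hκ hric
    (by rwa [Real.cos_sq', sin_quotAngle hφ hψ hlt hy ht])
    (hspace.isLocalMin_iff.1 hmin)
  rw [← hQ' y hy t ht] at hd'
  exact ⟨d, hd.congr_of_eventuallyEq htime, hd'⟩

end Coordinates

/-! ### Transfer between charts and the manifold -/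

section Manifold

variable {n : ℕ} {M : Type*} [TopologicalSpace M] [ChartedSpace (EuclideanSpace ℝ (Fin n)) M]
  [IsManifold (𝓡 n) ∞ M] {g : RiemannianMetric n M} {c x : M} {y : EuclideanSpace ℝ (Fin n)}

/-- The derivative of the inverse of the preferred chart at `c`. -/
noncomputable def chartSymmDeriv (c : M) (y : EuclideanSpace ℝ (Fin n)) :
    EuclideanSpace ℝ (Fin n) →L[ℝ] TangentSpace (𝓡 n) ((extChartAt (𝓡 n) c).symm y) :=
  mfderiv 𝓘(ℝ, EuclideanSpace ℝ (Fin n)) (𝓡 n) (extChartAt (𝓡 n) c).symm y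

theorem metricInChart_apply (g : RiemannianMetric n M) (c : M) (y v w : EuclideanSpace ℝ (Fin n)) :
    metricInChart g c y v w = g.inner ((extChartAt (𝓡 n) c).symm y)
      (chartSymmDeriv c y v) (chartSymmDeriv c y w) := rfl

theorem isInvertible_chartSymmDeriv (hy : y ∈ (extChartAt (𝓡 n) c).target) :
    (chartSymmDeriv c y).IsInvertible := by
  have h := isInvertible_mfderivWithin_extChartAt_symm (I := 𝓡 n) hy
  simp only [modelWithCornersSelf_coe, Set.range_id, mfderivWithin_univ] at h
  exact h

theorem bijective_chartSymmDeriv (hy : y ∈ (extChartAt (𝓡 n) c).target) :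
    Function.Bijective (chartSymmDeriv c y) := by
  obtain ⟨e, he⟩ := isInvertible_chartSymmDeriv hy
  rw [← he]
  exact e.bijective

theorem contMDiffAt_extChartAt_symm (hy : y ∈ (extChartAt (𝓡 n) c).target) :
    ContMDiffAt 𝓘(ℝ, EuclideanSpace ℝ (Fin n)) (𝓡 n) ∞ (extChartAt (𝓡 n) c).symm y :=
  (contMDiffOn_extChartAt_symm c).contMDiffAt ((isOpen_extChartAt_target c).mem_nhds hy)

/-- Over the chart domain the derivative of the inverse chart is the inverse of the tangent bundle
trivialization, which is smooth. -/
theorem contMDiffOn_chartSymmDeriv (v : EuclideanSpace ℝ (Fin n)) :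
    ContMDiffOn 𝓘(ℝ, EuclideanSpace ℝ (Fin n)) ((𝓡 n).prod 𝓘(ℝ, EuclideanSpace ℝ (Fin n))) ∞
      (fun y => (Bundle.TotalSpace.mk' (EuclideanSpace ℝ (Fin n))
        (E := (TangentSpace (𝓡 n) : M → Type _))
        ((extChartAt (𝓡 n) c).symm y) (chartSymmDeriv c y v)))
      (extChartAt (𝓡 n) c).target := by
  let e := trivializationAt (EuclideanSpace ℝ (Fin n)) (TangentSpace (𝓡 n) : M → Type _) c
  have h1 : ContMDiffOn 𝓘(ℝ, EuclideanSpace ℝ (Fin n))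
      ((𝓡 n).prod 𝓘(ℝ, EuclideanSpace ℝ (Fin n))) ∞
      (fun y => ((extChartAt (𝓡 n) c).symm y, v)) (extChartAt (𝓡 n) c).target :=
    (contMDiffOn_extChartAt_symm c).prodMk contMDiffOn_const
  have hmem : ∀ y ∈ (extChartAt (𝓡 n) c).target, (extChartAt (𝓡 n) c).symm y ∈ e.baseSet := by
    intro y hy
    have := (extChartAt (𝓡 n) c).map_target hy
    simpa [e] using this
  have h2 := (e.contMDiffOn_symm (IB := 𝓡 n) (n := ∞)).comp h1 (fun y hy => by
    rw [Set.mem_preimage, e.mem_target]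
    exact hmem y hy)
  refine h2.congr fun y hy => ?_
  have hy' : (extChartAt (𝓡 n) c).symm y ∈ (chartAt (EuclideanSpace ℝ (Fin n)) c).source := by
    have := (extChartAt (𝓡 n) c).map_target hy
    simpa using this
  have h3 := TangentBundle.symmL_trivializationAt (I := 𝓡 n) hy'
  rw [(extChartAt (𝓡 n) c).right_inv hy] at h3
  simp only [modelWithCornersSelf_coe, Set.range_id, mfderivWithin_univ] at h3
  rw [Function.comp_apply, ← e.mk_symm (hmem y hy)]
  refine congrArg _ ((congrArg (fun L => L v) h3).symm.trans ?_)
  exact e.symmL_apply (hmem y hy) _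

theorem isMetricOn_metricInChart (g : RiemannianMetric n M) (c : M) :
    IsMetricOn (metricInChart g c) (extChartAt (𝓡 n) c).target where
  isOpen := isOpen_extChartAt_target c
  smooth := by
    refine contDiffOn_clm_apply.2 fun v => contDiffOn_clm_apply.2 fun w => ?_
    have h1 : ContMDiffOn 𝓘(ℝ, EuclideanSpace ℝ (Fin n)) ((𝓡 n).prod 𝓘(ℝ, _)) ∞
        (fun y => Bundle.TotalSpace.mk'
          (EuclideanSpace ℝ (Fin n) →L[ℝ] EuclideanSpace ℝ (Fin n) →L[ℝ] ℝ)
          (E := fun x : M => TangentSpace (𝓡 n) x →L[ℝ] TangentSpace (𝓡 n) x →L[ℝ] ℝ)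
          ((extChartAt (𝓡 n) c).symm y) (g.inner ((extChartAt (𝓡 n) c).symm y)))
        (extChartAt (𝓡 n) c).target :=
      g.contMDiff.comp_contMDiffOn (contMDiffOn_extChartAt_symm c)
    intro y hy
    have h2 : ContMDiffWithinAt 𝓘(ℝ, EuclideanSpace ℝ (Fin n)) ((𝓡 n).prod 𝓘(ℝ, ℝ)) ∞
        (fun y => Bundle.TotalSpace.mk' ℝ (E := Bundle.Trivial M ℝ)
          ((extChartAt (𝓡 n) c).symm y) (metricInChart g c y v w))
        (extChartAt (𝓡 n) c).target y := by
      refine ContMDiffWithinAt.clm_bundle_apply₂ (E₁ := (TangentSpace (𝓡 n) : M → Type _))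
        (E₂ := (TangentSpace (𝓡 n) : M → Type _)) (E₃ := Bundle.Trivial M ℝ) (F₃ := ℝ) (F₁ := EuclideanSpace ℝ (Fin n))
        (F₂ := EuclideanSpace ℝ (Fin n)) (b := fun y => (extChartAt (𝓡 n) c).symm y)
        (ψ := fun y => g.inner ((extChartAt (𝓡 n) c).symm y))
        (v := fun y => chartSymmDeriv c y v) (w := fun y => chartSymmDeriv c y w) ?_ ?_ ?_
      · exact h1 y hy
      · exact contMDiffOn_chartSymmDeriv v y hy
      · exact contMDiffOn_chartSymmDeriv w y hy
    rw [Bundle.contMDiffWithinAt_totalSpace] at h2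
    exact h2.2.contDiffWithinAt
  symm y _ v w := g.symm ((extChartAt (𝓡 n) c).symm y) (chartSymmDeriv c y v) (chartSymmDeriv c y w)
  pos y hy v hv := by
    rw [metricInChart_apply]
    refine g.pos ((extChartAt (𝓡 n) c).symm y) (chartSymmDeriv c y v) fun h => hv ?_
    exact (bijective_chartSymmDeriv hy).1 (h.trans (map_zero (chartSymmDeriv c y)).symm)

/-- Views one tangent space as a flat coordinate space, so that nondegeneracy and invertibility need
no second proof. -/
theorem isMetricOn_inner (g : RiemannianMetric n M) (x : M) :
    IsMetricOn (E := EuclideanSpace ℝ (Fin n)) (fun _ => g.inner x) Set.univ where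
  isOpen := isOpen_univ
  smooth := contDiffOn_const
  symm _ _ v w := g.symm x v w
  pos _ _ v hv := g.pos x v hv

theorem inner_gradient (g : RiemannianMetric n M) (f : M → ℝ) (x : M) :
    g.inner x (gradient g f x) = mfderiv (𝓡 n) 𝓘(ℝ, ℝ) f x :=
  (isMetricOn_inner g x).apply_inverse (Set.mem_univ (0 : EuclideanSpace ℝ (Fin n))) _

theorem contDiffOn_comp_extChartAt_symm {f : M → ℝ} (hf : ContMDiff (𝓡 n) 𝓘(ℝ, ℝ) ∞ f) (c : M) :
    ContDiffOn ℝ ∞ (f ∘ (extChartAt (𝓡 n) c).symm) (extChartAt (𝓡 n) c).target :=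
  contMDiffOn_iff_contDiffOn.1 (hf.comp_contMDiffOn (contMDiffOn_extChartAt_symm c))

/-- The derivative of the inverse chart is an isometry onto the tangent space and carries the
coordinate gradient to the Riemannian one. -/
theorem gradNormSq_extChartAt_symm {f : M → ℝ} (hf : ContMDiff (𝓡 n) 𝓘(ℝ, ℝ) ∞ f)
    (hy : y ∈ (extChartAt (𝓡 n) c).target) :
    gradNormSq g f ((extChartAt (𝓡 n) c).symm y)
      = coordGradInner (metricInChart g c) (f ∘ (extChartAt (𝓡 n) c).symm)
        (f ∘ (extChartAt (𝓡 n) c).symm) y := by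
  have hG := isMetricOn_metricInChart g c
  have hd : fderiv ℝ (f ∘ (extChartAt (𝓡 n) c).symm) y
      = (mfderiv (𝓡 n) 𝓘(ℝ, ℝ) f ((extChartAt (𝓡 n) c).symm y)).comp (chartSymmDeriv c y) := by
    rw [← mfderiv_eq_fderiv]
    exact mfderiv_comp y ((hf _).mdifferentiableAt (by simp))
      ((contMDiffAt_extChartAt_symm hy).mdifferentiableAt (by simp))
  have h1 : chartSymmDeriv c y (coordGradient (metricInChart g c)
      (f ∘ (extChartAt (𝓡 n) c).symm) y) = gradient g f ((extChartAt (𝓡 n) c).symm y) := by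
    refine (isMetricOn_inner g ((extChartAt (𝓡 n) c).symm y)).ext
      (Set.mem_univ (0 : EuclideanSpace ℝ (Fin n))) fun w => ?_
    obtain ⟨w, rfl⟩ := (bijective_chartSymmDeriv hy).2 w
    refine (metricInChart_apply g c y _ w).symm.trans ?_
    rw [hG.apply_gradient hy, hd]
    exact (congrArg (fun L => L (chartSymmDeriv c y w)) (inner_gradient g f _)).symm
  rw [gradNormSq, coordGradInner, metricInChart_apply, h1]

/-- `laplacian` changes chart with the point. Transition maps are isometries of the coordinate
metrics, so a single chart computes it on a whole neighbourhood, where it can then be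
differentiated. -/
theorem laplacian_extChartAt_symm {f : M → ℝ} (hf : ContMDiff (𝓡 n) 𝓘(ℝ, ℝ) ∞ f)
    (hy : y ∈ (extChartAt (𝓡 n) c).target) :
    laplacian g f ((extChartAt (𝓡 n) c).symm y)
      = coordLaplacian (metricInChart g c) (f ∘ (extChartAt (𝓡 n) c).symm) y := by
  obtain ⟨x, hx⟩ : ∃ x, x = (extChartAt (𝓡 n) c).symm y := ⟨_, rfl⟩
  set U' := (extChartAt (𝓡 n) c).target ∩
    (extChartAt (𝓡 n) c).symm ⁻¹' (extChartAt (𝓡 n) x).source with hU'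
  have hU'o : IsOpen U' := (continuousOn_extChartAt_symm c).isOpen_inter_preimage
    (isOpen_extChartAt_target c) (isOpen_extChartAt_source x)
  have hyU' : y ∈ U' := ⟨hy, by rw [Set.mem_preimage, ← hx]; exact mem_extChartAt_source x⟩
  have hGc := isMetricOn_metricInChart g c
  have hG' : IsMetricOn (metricInChart g c) U' :=
    ⟨hU'o, hGc.smooth.mono Set.inter_subset_left, fun z hz => hGc.symm z hz.1,
      fun z hz => hGc.pos z hz.1⟩
  set Φ := extChartAt (𝓡 n) x ∘ (extChartAt (𝓡 n) c).symm with hΦdef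
  have hΦm : ContMDiffOn 𝓘(ℝ, EuclideanSpace ℝ (Fin n)) 𝓘(ℝ, EuclideanSpace ℝ (Fin n)) ∞ Φ U' :=
    contMDiffOn_extChartAt.comp ((contMDiffOn_extChartAt_symm c).mono Set.inter_subset_left)
      fun z hz => by simpa using hz.2
  have hΦ : ContDiffOn ℝ ∞ Φ U' := contMDiffOn_iff_contDiffOn.1 hΦm
  have hmaps : Set.MapsTo Φ U' (extChartAt (𝓡 n) x).target :=
    fun z hz => (extChartAt (𝓡 n) x).map_source hz.2
  have hcomp : ∀ z ∈ U', (extChartAt (𝓡 n) x).symm (Φ z) = (extChartAt (𝓡 n) c).symm z :=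
    fun z hz => (extChartAt (𝓡 n) x).left_inv hz.2
  have hiso : ∀ z ∈ U', ∀ v w, metricInChart g c z v w
      = metricInChart g x (Φ z) (fderiv ℝ Φ z v) (fderiv ℝ Φ z w) := by
    intro z hz v w
    have hev : (extChartAt (𝓡 n) x).symm ∘ Φ =ᶠ[𝓝 z] (extChartAt (𝓡 n) c).symm := by
      filter_upwards [hU'o.mem_nhds hz] with z' hz' using hcomp z' hz'
    have h1 : (mfderiv 𝓘(ℝ, EuclideanSpace ℝ (Fin n)) (𝓡 n) ((extChartAt (𝓡 n) x).symm ∘ Φ) z)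
        = (chartSymmDeriv x (Φ z)).comp (fderiv ℝ Φ z) := by
      rw [← mfderiv_eq_fderiv]
      exact mfderiv_comp z
        ((contMDiffAt_extChartAt_symm (hmaps hz)).mdifferentiableAt (by simp))
        ((hΦm.contMDiffAt (hU'o.mem_nhds hz)).mdifferentiableAt (by simp))
    have h2 : ∀ u : EuclideanSpace ℝ (Fin n),
        (show EuclideanSpace ℝ (Fin n) from chartSymmDeriv c z u)
          = (show EuclideanSpace ℝ (Fin n) from chartSymmDeriv x (Φ z) (fderiv ℝ Φ z u)) := by
      intro u
      have h3 := hev.mfderiv_eq (I := 𝓘(ℝ, EuclideanSpace ℝ (Fin n))) (I' := 𝓡 n)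
      exact (congrArg (fun L : EuclideanSpace ℝ (Fin n) →L[ℝ] EuclideanSpace ℝ (Fin n) => L u)
        (h3.symm.trans h1))
    have h4 : ∀ p q : M, p = q → ∀ v w : EuclideanSpace ℝ (Fin n),
        g.inner p v w = g.inner q v w := by
      rintro p _ rfl v w; rfl
    rw [metricInChart_apply, metricInChart_apply]
    refine (h4 _ _ (hcomp z hz).symm _ _).trans ?_
    exact congrArg₂ (fun v w : EuclideanSpace ℝ (Fin n) =>
      g.inner ((extChartAt (𝓡 n) x).symm (Φ z)) v w) (h2 v) (h2 w)
  have h := (isMetricOn_metricInChart g x).laplacian_comp_isometry hG' hΦ hmaps hiso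
    (contDiffOn_comp_extChartAt_symm hf x) hyU'
  have hev : (f ∘ (extChartAt (𝓡 n) x).symm) ∘ Φ =ᶠ[𝓝 y] f ∘ (extChartAt (𝓡 n) c).symm := by
    filter_upwards [hU'o.mem_nhds hyU'] with z hz
    exact congrArg f (hcomp z hz)
  rw [← coordLaplacian_congr hev, h, hΦdef, Function.comp_apply, ← hx, laplacian]

/-- At the centre of its own chart the derivatives of the chart and of its inverse are the identity.
The curvature bound is used only at such centres, so no invariance of Ricci is required. -/
theorem RicciGE.coordRicci_ge {κ : ℝ} (h : RicciGE g κ) (x : M) (v : EuclideanSpace ℝ (Fin n)) :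
    κ * metricInChart g x (extChartAt (𝓡 n) x x) v v
      ≤ coordRicci (metricInChart g x) (extChartAt (𝓡 n) x x) v v := by
  have h1 : κ * g.inner x v v ≤ coordRicci (metricInChart g x) (extChartAt (𝓡 n) x x)
    (mfderiv (𝓡 n) 𝓘(ℝ, EuclideanSpace ℝ (Fin n)) (extChartAt (𝓡 n) x) x v)
    (mfderiv (𝓡 n) 𝓘(ℝ, EuclideanSpace ℝ (Fin n)) (extChartAt (𝓡 n) x) x v) := h x v
  have h2 : mfderiv (𝓡 n) 𝓘(ℝ, EuclideanSpace ℝ (Fin n)) (extChartAt (𝓡 n) x) x v = v := by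
    rw [mfderiv_extChartAt_self]; rfl
  have h3 : (show EuclideanSpace ℝ (Fin n) from chartSymmDeriv x (extChartAt (𝓡 n) x x) v) = v := by
    have h4 := mfderivWithin_range_extChartAt_symm (I := 𝓡 n) (x := x)
    simp only [modelWithCornersSelf_coe, Set.range_id, mfderivWithin_univ] at h4
    exact congrArg (fun L : EuclideanSpace ℝ (Fin n) →L[ℝ] EuclideanSpace ℝ (Fin n) => L v) h4
  have h5 : metricInChart g x (extChartAt (𝓡 n) x x) v v = g.inner x v v := by
    have h6 : ∀ p : M, p = x → ∀ w : EuclideanSpace ℝ (Fin n), w = v →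
        g.inner p w w = g.inner x v v := by
      rintro _ rfl _ rfl; rfl
    exact h6 _ (extChartAt_to_inv x) _ h3
  rw [h2] at h1
  rw [h5]
  exact h1

theorem IsSolution.contMDiff {a : ℝ} {T : EReal} {u : M → ℝ → ℝ} (hu : IsSolution g a T u) {t : ℝ}
    (ht : 0 < t ∧ (t : EReal) < T) : ContMDiff (𝓡 n) 𝓘(ℝ, ℝ) ∞ (fun z => u z t) := by
  rw [← contMDiffOn_univ]
  exact hu.smooth.comp (contMDiffOn_id.prodMk contMDiffOn_const) fun _ _ => ht

theorem IsSolution.isCoordSolution {a : ℝ} {T : EReal} {u : M → ℝ → ℝ} (hu : IsSolution g a T u)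
    (hpos : ∀ (x : M) (t : ℝ), 0 < t → (t : EReal) < T → 0 < u x t) (c : M) :
    IsCoordSolution (metricInChart g c) (extChartAt (𝓡 n) c).target
      {t : ℝ | 0 < t ∧ (t : EReal) < T} a (fun y t => u ((extChartAt (𝓡 n) c).symm y) t) where
  smooth := by
    have h1 : ContMDiffOn 𝓘(ℝ, EuclideanSpace ℝ (Fin n) × ℝ) ((𝓡 n).prod 𝓘(ℝ, ℝ)) ∞
        (fun p : EuclideanSpace ℝ (Fin n) × ℝ => ((extChartAt (𝓡 n) c).symm p.1, p.2))
        ((extChartAt (𝓡 n) c).target ×ˢ {t : ℝ | 0 < t ∧ (t : EReal) < T}) :=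
      ((contMDiffOn_extChartAt_symm c).comp contDiff_fst.contMDiff.contMDiffOn
        fun p hp => hp.1).prodMk contDiff_snd.contMDiff.contMDiffOn
    exact contMDiffOn_iff_contDiffOn.1 (hu.smooth.comp h1 fun p hp => hp.2)
  pos y _ t ht := hpos _ t ht.1 ht.2
  equation y hy t ht := by
    rw [hu.equation _ t ht.1 ht.2, laplacian_extChartAt_symm (hu.contMDiff ht) hy]
    rfl

end Manifold

/-! ### The time weight τ -/

/-- A derivative at a minimum over a left interval is nonpositive. -/
theorem deriv_nonpos_of_left_min {u : ℝ → ℝ} {c b t : ℝ} (hu : HasDerivAt u c t) (hb : b < t)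
    (hmin : ∀ s, b ≤ s → s ≤ t → u t ≤ u s) : c ≤ 0 := by
  have h := (hasDerivAt_iff_tendsto_slope_left_right.1 hu).1
  refine le_of_tendsto h ?_
  filter_upwards [Ioo_mem_nhdsLT hb] with s hs
  rw [slope_def_field]
  exact div_nonpos_of_nonneg_of_nonpos (sub_nonneg.2 (hmin s hs.1.le hs.2.le))
    (sub_nonpos.2 hs.2.le)

/-- `(1 - e^{-as}) / a`, the solution of `τ' = 1 - a τ`, `τ(0) = 0`. -/
noncomputable def expTime (a s : ℝ) : ℝ := (1 - Real.exp (-a * s)) / a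

theorem expTime_pos {a s : ℝ} (ha : a ≠ 0) (hs : 0 < s) : 0 < expTime a s := by
  rcases lt_or_gt_of_ne ha with h | h
  · refine div_pos_of_neg_of_neg ?_ h
    rw [sub_neg, Real.one_lt_exp_iff]
    nlinarith
  · refine div_pos ?_ h
    rw [sub_pos, Real.exp_lt_one_iff]
    nlinarith

@[simp]
theorem expTime_zero (a : ℝ) : expTime a 0 = 0 := by simp [expTime]

theorem hasDerivAt_expTime {a : ℝ} (ha : a ≠ 0) (s : ℝ) :
    HasDerivAt (expTime a) (1 - a * expTime a s) s := by
  have h := ((((hasDerivAt_id s).const_mul (-a)).exp).const_sub 1).div_const a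
  refine h.congr_deriv ?_
  simp only [expTime, id]
  field_simp
  ring

theorem continuous_expTime {a : ℝ} : Continuous (expTime a) := by
  unfold expTime
  fun_prop

/-! ### The Harnack quantity and the minimum principle on the closed manifold -/

section Manifold

variable {n : ℕ} {M : Type*} [TopologicalSpace M] [ChartedSpace (EuclideanSpace ℝ (Fin n)) M]
  [IsManifold (𝓡 n) ∞ M] {g : RiemannianMetric n M} {a : ℝ} {T : EReal} {φ ψ u : M → ℝ → ℝ}
  {t : ℝ} {x : M}

theorem isOpen_timeInterval (T : EReal) : IsOpen {t : ℝ | 0 < t ∧ (t : EReal) < T} :=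
  (isOpen_lt continuous_const continuous_id).inter
    (isOpen_lt continuous_coe_real_ereal continuous_const)

theorem IsSolution.contMDiff_log (hu : IsSolution g a T u)
    (hpos : ∀ (x : M) (t : ℝ), 0 < t → (t : EReal) < T → 0 < u x t)
    (ht : 0 < t ∧ (t : EReal) < T) :
    ContMDiff (𝓡 n) 𝓘(ℝ, ℝ) ∞ (fun z => Real.log (u z t)) := fun z =>
  (Real.contDiffAt_log.2 (hpos z t ht.1 ht.2).ne').contMDiffAt.comp z (hu.contMDiff ht z)

/-- The evolution equation of `ln u`. -/
theorem IsSolution.deriv_log (hu : IsSolution g a T u)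
    (hpos : ∀ (x : M) (t : ℝ), 0 < t → (t : EReal) < T → 0 < u x t)
    (ht : 0 < t ∧ (t : EReal) < T) :
    deriv (fun s => Real.log (u x s)) t = laplacian g (fun z => Real.log (u z t)) x
      + gradNormSq g (fun z => Real.log (u z t)) x + a * Real.log (u x t) := by
  have hy := mem_extChartAt_target (I := 𝓡 n) x
  have h := (hu.isCoordSolution hpos x).deriv_log (isMetricOn_metricInChart g x)
    (isOpen_timeInterval T) hy ht
  have h1 := laplacian_extChartAt_symm (g := g) (hu.contMDiff_log hpos ht) hy
  have h2 := gradNormSq_extChartAt_symm (g := g) (hu.contMDiff_log hpos ht) hy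
  rw [extChartAt_to_inv] at h h1 h2
  rw [h, h1, h2]
  rfl

/-- `Δ ln ψ - |∇h|² / (1 - h²)` with `h = φ / ψ`. -/
noncomputable def harnackQuantity (g : RiemannianMetric n M) (φ ψ : M → ℝ → ℝ) (x : M) (t : ℝ) :
    ℝ :=
  laplacian g (fun z => Real.log (ψ z t)) x
    - gradNormSq g (fun z => φ z t / ψ z t) x / (1 - (φ x t / ψ x t) ^ 2)

section Pair

variable (hφ : IsSolution g a T φ) (hψ : IsSolution g a T ψ)
  (hpos : ∀ (x : M) (t : ℝ), 0 < t → (t : EReal) < T → 0 < φ x t)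
  (hlt : ∀ (x : M) (t : ℝ), 0 < t → (t : EReal) < T → φ x t < ψ x t)

include hφ hψ hpos hlt

theorem harnackQuantity_extChartAt_symm (c : M) {y : EuclideanSpace ℝ (Fin n)}
    (hy : y ∈ (extChartAt (𝓡 n) c).target) (ht : 0 < t ∧ (t : EReal) < T) :
    harnackQuantity g φ ψ ((extChartAt (𝓡 n) c).symm y) t
      = coordLaplacian (metricInChart g c)
          (fun z => Real.log (ψ ((extChartAt (𝓡 n) c).symm z) t)) y
        - coordGradInner (metricInChart g c)
            (fun z => φ ((extChartAt (𝓡 n) c).symm z) t / ψ ((extChartAt (𝓡 n) c).symm z) t)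
            (fun z => φ ((extChartAt (𝓡 n) c).symm z) t / ψ ((extChartAt (𝓡 n) c).symm z) t) y
          / (1 - (φ ((extChartAt (𝓡 n) c).symm y) t / ψ ((extChartAt (𝓡 n) c).symm y) t) ^ 2) := by
  have hψpos : ∀ (x : M) (t : ℝ), 0 < t → (t : EReal) < T → 0 < ψ x t :=
    fun x t h0 hT => (hpos x t h0 hT).trans (hlt x t h0 hT)
  have hq : ContMDiff (𝓡 n) 𝓘(ℝ, ℝ) ∞ (fun z => φ z t / ψ z t) :=
    (hφ.contMDiff ht).div₀ (hψ.contMDiff ht) fun z => (hψpos z t ht.1 ht.2).ne'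
  rw [harnackQuantity, laplacian_extChartAt_symm (hψ.contMDiff_log hψpos ht) hy,
    gradNormSq_extChartAt_symm hq hy]
  rfl

theorem continuousOn_harnackQuantity_prod :
    ContinuousOn (fun p : M × ℝ => harnackQuantity g φ ψ p.1 p.2)
      (Set.univ ×ˢ {t : ℝ | 0 < t ∧ (t : EReal) < T}) := by
  rintro ⟨c, t⟩ ⟨-, ht⟩
  refine ContinuousAt.continuousWithinAt ?_
  have hψpos : ∀ (x : M) (t : ℝ), 0 < t → (t : EReal) < T → 0 < ψ x t :=
    fun x t h0 hT => (hpos x t h0 hT).trans (hlt x t h0 hT)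
  have hJ := isOpen_timeInterval T
  have h1 := continuousOn_harnackQuantity (hφ.isCoordSolution hpos c)
    (hψ.isCoordSolution hψpos c) (fun y _ t ht => hlt _ t ht.1 ht.2)
    (isMetricOn_metricInChart g c) hJ
  have h2 := h1.continuousAt (x := (extChartAt (𝓡 n) c c, t))
    (((isOpen_extChartAt_target c).prod hJ).mem_nhds ⟨mem_extChartAt_target c, ht⟩)
  have h3 : ContinuousAt (fun p : M × ℝ => (extChartAt (𝓡 n) c p.1, p.2)) (c, t) :=
    (ContinuousAt.comp (g := extChartAt (𝓡 n) c) (f := Prod.fst) (x := (c, t))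
      (continuousAt_extChartAt c) continuousAt_fst).prodMk continuousAt_snd
  refine (ContinuousAt.comp (f := fun p : M × ℝ => (extChartAt (𝓡 n) c p.1, p.2)) h2 h3).congr ?_
  filter_upwards [((isOpen_extChartAt_source (I := 𝓡 n) c).prod hJ).mem_nhds
    ⟨mem_extChartAt_source c, ht⟩] with p hp
  have h4 := harnackQuantity_extChartAt_symm hφ hψ hpos hlt c
    ((extChartAt (𝓡 n) c).map_source hp.1) hp.2
  simp only [Function.comp_apply]
  rw [← h4, (extChartAt (𝓡 n) c).left_inv hp.1]

/-- The differential inequality satisfied by the Harnack quantity at a spatial minimum. -/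
theorem harnackQuantity_ode {κ : ℝ} (ht : 0 < t ∧ (t : EReal) < T) (hκ : 0 ≤ κ)
    (hric : RicciGE g κ)
    (haκ : a * (1 + 2 * Real.log (φ x t / ψ x t) / (1 - (φ x t / ψ x t) ^ 2)) ≤ 2 * κ)
    (hmin : ∀ z, harnackQuantity g φ ψ x t ≤ harnackQuantity g φ ψ z t) :
    ∃ d, HasDerivAt (fun s => harnackQuantity g φ ψ x s) d t ∧
      2 * harnackQuantity g φ ψ x t ^ 2 ≤ n * (d - a * harnackQuantity g φ ψ x t) := by
  have hψpos : ∀ (x : M) (t : ℝ), 0 < t → (t : EReal) < T → 0 < ψ x t :=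
    fun x t h0 hT => (hpos x t h0 hT).trans (hlt x t h0 hT)
  have h := harnackQuantity_inequality (hφ.isCoordSolution hpos x)
    (hψ.isCoordSolution hψpos x) (fun y _ t ht => hlt _ t ht.1 ht.2)
    (isMetricOn_metricInChart g x) (isOpen_timeInterval T) (mem_extChartAt_target x) ht hκ
    (hric.coordRicci_ge x) (by rwa [extChartAt_to_inv])
    (Q := fun y t => harnackQuantity g φ ψ ((extChartAt (𝓡 n) x).symm y) t)
    (fun y hy t ht => harnackQuantity_extChartAt_symm hφ hψ hpos hlt x hy ht)
    (Eventually.of_forall fun z => by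
      simp only [extChartAt_to_inv]
      exact hmin _)
  simpa only [extChartAt_to_inv, finrank_euclideanSpace_fin] using h

variable [CompactSpace M]

/-- Nothing is known about the solutions as t → 0, so the weight is started at time ε, where its
vanishing excludes a very negative minimum. -/
theorem expTime_mul_harnackQuantity_ge {κ ε : ℝ} (ha : a ≠ 0) (hκ : 0 ≤ κ) (hric : RicciGE g κ)
    (haκ : ∀ (x : M) (t : ℝ), 0 < t → (t : EReal) < T →
      a * (1 + 2 * Real.log (φ x t / ψ x t) / (1 - (φ x t / ψ x t) ^ 2)) ≤ 2 * κ)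
    (hε : 0 < ε) (hεt : ε < t) (htT : (t : EReal) < T) :
    -(n / 2 : ℝ) ≤ expTime a (t - ε) * harnackQuantity g φ ψ x t := by
  have hJ : ∀ s ∈ Set.Icc ε t, 0 < s ∧ (s : EReal) < T := fun s hs =>
    ⟨hε.trans_le hs.1, (EReal.coe_le_coe_iff.2 hs.2).trans_lt htT⟩
  have hcont : ContinuousOn (fun p : M × ℝ => expTime a (p.2 - ε) * harnackQuantity g φ ψ p.1 p.2)
      (Set.univ ×ˢ Set.Icc ε t) :=
    (continuous_expTime.comp (continuous_snd.sub continuous_const)).continuousOn.mul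
      ((continuousOn_harnackQuantity_prod hφ hψ hpos hlt).mono
        (Set.prod_mono le_rfl hJ))
  obtain ⟨⟨x₀, t₀⟩, ⟨-, ht₀⟩, hmin⟩ := (isCompact_univ.prod isCompact_Icc).exists_isMinOn
    ⟨(x, t), Set.mem_univ _, hεt.le, le_rfl⟩ hcont
  have hle : ∀ z, ∀ s ∈ Set.Icc ε t, expTime a (t₀ - ε) * harnackQuantity g φ ψ x₀ t₀
      ≤ expTime a (s - ε) * harnackQuantity g φ ψ z s :=
    fun z s hs => hmin (a := (z, s)) ⟨Set.mem_univ _, hs⟩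
  refine le_trans ?_ (hle x t ⟨hεt.le, le_rfl⟩)
  by_contra! hneg
  have hn : (0 : ℝ) ≤ n := Nat.cast_nonneg n
  have hεt₀ : ε < t₀ := by
    refine lt_of_le_of_ne ht₀.1 fun h => ?_
    rw [← h] at hneg
    simp at hneg
    linarith
  have hτ : 0 < expTime a (t₀ - ε) := expTime_pos ha (sub_pos.2 hεt₀)
  have hJ₀ := hJ t₀ ht₀
  obtain ⟨d, hd, hineq⟩ := harnackQuantity_ode hφ hψ hpos hlt hJ₀ hκ hric
    (haκ x₀ t₀ hJ₀.1 hJ₀.2) fun z => le_of_mul_le_mul_left (hle z t₀ ht₀) hτ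
  have hτd : HasDerivAt (fun s => expTime a (s - ε)) (1 - a * expTime a (t₀ - ε)) t₀ :=
    (hasDerivAt_expTime ha (t₀ - ε)).comp_sub_const t₀ ε
  -- The minimum may sit at the final time, so only the comparison with earlier times is available.
  have htime := deriv_nonpos_of_left_min (hτd.mul hd) hεt₀
    fun s hs hs' => hle x₀ s ⟨hs, hs'.trans ht₀.2⟩
  generalize harnackQuantity g φ ψ x₀ t₀ = Q at *
  generalize expTime a (t₀ - ε) = τ at *
  have hQ : Q < 0 := by
    by_contra! h
    nlinarith [mul_nonneg hτ.le h]
  -- Here 0 ≥ n(τQ)' = nQ + nτ(d - aQ) ≥ nQ + 2τQ²; the choice τ' = 1 - aτ absorbs the term aQ.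
  -- Dividing by Q < 0 contradicts `hneg`.
  have h1 : 2 * (τ * Q) * Q ≤ -n * Q := by
    nlinarith [mul_le_mul_of_nonneg_left hineq hτ.le, mul_le_mul_of_nonneg_left htime hn]
  nlinarith

theorem harnackQuantity_ge {κ : ℝ} (ha : a ≠ 0) (hκ : 0 ≤ κ) (hric : RicciGE g κ)
    (haκ : ∀ (x : M) (t : ℝ), 0 < t → (t : EReal) < T →
      a * (1 + 2 * Real.log (φ x t / ψ x t) / (1 - (φ x t / ψ x t) ^ 2)) ≤ 2 * κ)
    (ht : 0 < t) (htT : (t : EReal) < T) :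
    -(a * n / (2 * (1 - Real.exp (-a * t)))) ≤ harnackQuantity g φ ψ x t := by
  have hlim : Tendsto (fun ε => expTime a (t - ε) * harnackQuantity g φ ψ x t) (𝓝[>] 0)
      (𝓝 (expTime a t * harnackQuantity g φ ψ x t)) := by
    have h1 : Continuous fun ε => expTime a (t - ε) * harnackQuantity g φ ψ x t :=
      (continuous_expTime.comp (continuous_const.sub continuous_id)).mul continuous_const
    have h2 := h1.tendsto 0
    rw [sub_zero] at h2
    exact h2.mono_left nhdsWithin_le_nhds
  have h := ge_of_tendsto hlim (by
    filter_upwards [Ioo_mem_nhdsGT ht] with ε hε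
    exact expTime_mul_harnackQuantity_ge hφ hψ hpos hlt ha hκ hric haκ hε.1 hε.2 htT)
  have hτ := expTime_pos ha ht
  have h3 : a * n / (2 * (1 - Real.exp (-a * t))) = (n / 2) / expTime a t := by
    rw [expTime] at hτ ⊢
    have : 1 - Real.exp (-a * t) ≠ 0 := fun h0 => by
      rw [h0, zero_div] at hτ
      exact hτ.false
    field_simp
  rw [h3, ← neg_div, div_le_iff₀ hτ]
  linarith

end Pair

end Manifold

end RiemGeom

theorem mainTheorem1 {n : ℕ} {M : Type*} [TopologicalSpace M] [T2Space M] [CompactSpace M]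
    [ChartedSpace (EuclideanSpace ℝ (Fin n)) M] [IsManifold (𝓡 n) ∞ M]
    (g : RiemGeom.RiemannianMetric n M) (a : ℝ) (T : EReal) (φ ψ : M → ℝ → ℝ)
    (hφ : RiemGeom.IsSolution g a T φ) (hψ : RiemGeom.IsSolution g a T ψ)
    (hpos : ∀ (x : M) (t : ℝ), 0 < t → (t : EReal) < T → 0 < φ x t)
    (hlt : ∀ (x : M) (t : ℝ), 0 < t → (t : EReal) < T → φ x t < ψ x t)
    (hcase : (0 < a ∧ RiemGeom.RicciGE g 0) ∨
      (a < 0 ∧ ∃ c₀ K : ℝ, 0 < c₀ ∧ c₀ < 1 ∧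
        (∀ (x : M) (t : ℝ), 0 < t → (t : EReal) < T → c₀ * ψ x t < φ x t) ∧
        -(Real.log c₀ / (1 - c₀ ^ 2)) - 1 / 2 ≤ K ∧ RiemGeom.RicciGE g (-a * K))) :
    ∀ (x : M) (t : ℝ), 0 < t → (t : EReal) < T →
      deriv (fun s => Real.log (ψ x s)) t - RiemGeom.gradNormSq g (fun z => Real.log (ψ z t)) x
            - a * Real.log (ψ x t) + a * n / (2 * (1 - Real.exp (-a * t)))
          = RiemGeom.laplacian g (fun z => Real.log (ψ z t)) x
            + a * n / (2 * (1 - Real.exp (-a * t))) ∧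
        RiemGeom.gradNormSq g (fun z => φ z t / ψ z t) x / (1 - (φ x t / ψ x t) ^ 2)
          ≤ RiemGeom.laplacian g (fun z => Real.log (ψ z t)) x
            + a * n / (2 * (1 - Real.exp (-a * t))) := by
  intro x t ht htT
  have hψpos : ∀ (x : M) (t : ℝ), 0 < t → (t : EReal) < T → 0 < ψ x t :=
    fun x t h0 hT => (hpos x t h0 hT).trans (hlt x t h0 hT)
  refine ⟨by rw [hψ.deriv_log hψpos ⟨ht, htT⟩]; ring, ?_⟩
  have hquot : ∀ (x : M) (t : ℝ), 0 < t → (t : EReal) < T →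
      0 < φ x t / ψ x t ∧ φ x t / ψ x t < 1 := fun x t h0 hT =>
    ⟨div_pos (hpos x t h0 hT) (hψpos x t h0 hT),
      (div_lt_one (hψpos x t h0 hT)).2 (hlt x t h0 hT)⟩
  have ha : a ≠ 0 := by
    rcases hcase with h | h
    · exact h.1.ne'
    · exact h.1.ne
  -- For a > 0 take κ = 0, since 1 + 2 ln h/(1 - h²) ≤ 0. For a < 0 take κ = -aK: monotonicity and h
  -- > c₀ give 1 + 2 ln h/(1 - h²) ≥ -2K, and multiplication by a reverses the inequality.
  obtain ⟨κ, hκ, hric, haκ⟩ : ∃ κ : ℝ, 0 ≤ κ ∧ RiemGeom.RicciGE g κ ∧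
      ∀ (x : M) (t : ℝ), 0 < t → (t : EReal) < T →
        a * (1 + 2 * Real.log (φ x t / ψ x t) / (1 - (φ x t / ψ x t) ^ 2)) ≤ 2 * κ := by
    rcases hcase with ⟨ha0, hric⟩ | ⟨ha0, c₀, K, hc0, hc1, hc, hK, hric⟩
    · refine ⟨0, le_rfl, hric, fun x t h0 hT => ?_⟩
      have h := RiemGeom.log_div_one_sub_sq_le (hquot x t h0 hT).1 (hquot x t h0 hT).2
      rw [mul_div_assoc]
      nlinarith
    · have hK0 : 0 ≤ K := by linarith [RiemGeom.log_div_one_sub_sq_le hc0 hc1]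
      refine ⟨-a * K, mul_nonneg (by linarith) hK0, hric, fun x t h0 hT => ?_⟩
      have h := RiemGeom.log_div_one_sub_sq_mono hc0
        ((lt_div_iff₀ (hψpos x t h0 hT)).2 (hc x t h0 hT)) (hquot x t h0 hT).2
      rw [mul_div_assoc]
      nlinarith
  have h := RiemGeom.harnackQuantity_ge hφ hψ hpos hlt ha hκ hric haκ (x := x) ht htT
  rw [RiemGeom.harnackQuantity] at h
  linarith
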